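/- **Definitions.** A colored string is a string $S=S[1,n]$ with a color $f(p)$ for every position $p\in\{1,\dots,n\}$. Let $y$ be a color and $d\ge 0$ an integer. A substring $T$ of $S$ (possibly empty; the empty string occurs at $1,\dots,n+1$) is *$(y,d)$-unique* if for every occurrence $i$ of $T$, with $e=i+|T|-1$ its end position, $f(e+d)=y$ or $e+d>n$ (position $0$ has no color). It is *minimally $(y,d)$-unique* if it is $(y,d)$-unique and no proper, possibly empty, substring $U=T[i,j]$ of $T$ is $(y,d+|T|-j)$-unique. Let $\mathcal T$ be the suffix tree of $S^{\mathrm{rev}}\$$ and $L(u)$ the string represented by a node $u$. Number the $k$ nodes by $iBFS(u)=k-r(u)$, where $r(u)$ is the rank of $u$ in a breadth-first traversal (or any listing of the nodes by nondecreasing depth). For a node $u$ with parent $v$ such that the label of the edge $(v,u)$ is not $\$$, let $\mathrm{Left\text{-}min}(u)=x_1L(v)^{\mathrm{rev}}$, where $x_1$ is the first character of the label, and let $u'$ be the node at or directly below the locus of the string obtained from $L(v)x_1$ by deleting its first character. **Algorithm Skipping**, for $S$ and $y$. Let $b_y[1,2n]$ be the bitvector with $b_y[p]=1$ iff $f(p)=y$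 or $p>n$, preprocessed for $\mathrm{rank}(p)=\#\{q<p: b_y[q]=1\}$ and $\mathrm{select}(r)$, the position of the $r$-th one ($\mathrm{select}(0)=-1$). Insert all nodes with key $n+1$ into an indexed max-priority queue, with index $iBFS$ and ties broken in favor of the larger index. While some key is nonnegative: 1. let $(u,d)$ be the node of maximum key together with its key; 2. if $\mathrm{Left\text{-}min}(u)$ is defined and $u'$ was not extracted with key $d+1$, output $(\mathrm{Left\text{-}min}(u),d)$; record that $u$ was extracted with key $d$; 3. compute $m=h(u,d)$ by the recursion $h(u,\ell)=\max\{\mathrm{select}(\mathrm{rank}(j+\ell))-j,\,-1\}$ if $u$ is the leaf for the prefix of $S$ of length $j$, and $h(u,\ell)=\min(\{\ell-1\}\cup\{h(v,\ell): v\text{ child of }u\})$ if $u$ is an inner node; demote every node visited by the recursion to its value; 4. going from the parent of $u$ up to the root, demote every ancestor with key $>m$ to $m$. Step 4 may either visit all ancestors of $u$, or stop at the first ancestor whose key is $\le m$. **Cost model.** The suffix tree with its suffix links is given. Following a pointer in it, an array access, an arithmetic operation or comparison, and reporting a pair (by reference to its locus) take one step. The queue is implemented by a tournament tree, so that `insert`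 and `demote` take $O(\log k)$ steps and `max`, `keyOf` and `allNegative` take $O(1)$ steps. The preprocessing of $b_y$ and the insertions are part of the running time. **Theorem.** There is an absolute constant $C$ such that for every colored string $S$ and every color $y$, and for both versions of step 4, the algorithm terminates, and * the pairs that it outputs are exactly the pairs $(T,d)$ with $0\le d\le n$ such that $T$ is a nonempty minimally $(y,d)$-unique substring of $S$; * every node's key is demoted at most $n+2$ times; * if $n\ge 2$, the number of steps, not counting the visits of step 4 to ancestors that are not demoted, is at most $C\,n^2\log n$; * if $n\ge 2$ and step 4 stops at the first ancestor whose key is $\le m$, the total number of steps is at most $C\,n^2\log n$. -/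

import Mathlib

namespace ColoredStrings

universe u v

/-! Colored strings, `(y,d)`-uniqueness and minimality. All positions are 1-based. -/

/-- A colored string: a string together with a color for each of its positions. -/
structure ColoredString (α : Type u) (γ : Type v) where
  str : List α
  color : Fin str.length → γ

section Strings

variable {α : Type u} {γ : Type v}

/-- The length `n` of the string. -/
def ColoredString.len (S : ColoredString α γ) : ℕ := S.str.length

/-- The color `f(p)` of position `p`; there is none outside `1, …, n`. -/
def ColoredString.colorAt (S : ColoredString α γ) (p : ℕ) : Option γ :=
  if h : 1 ≤ p ∧ p - 1 < S.str.length then some (S.color ⟨p - 1, h.2⟩) else none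

/-- `T` occurs in `S` at position `i`. The empty string occurs at `1, …, n + 1`. -/
def IsOcc (S : ColoredString α γ) (T : List α) (i : ℕ) : Prop :=
  1 ≤ i ∧ i + T.length ≤ S.len + 1 ∧ (S.str.drop (i - 1)).take T.length = T

/-- The occurrence `i` of `T` is `y`-good with delay `d`: `f(i + |T| - 1 + d) = y`. -/
def IsGood (S : ColoredString α γ) (y : γ) (d : ℕ) (T : List α) (i : ℕ) : Prop :=
  S.colorAt (i + T.length - 1 + d) = some y

/-- `T` is a `y`-unique substring of `S` with delay `d`. -/
def IsUnique (S : ColoredString α γ) (y : γ) (d : ℕ) (T : List α) : Prop :=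
  T <:+: S.str ∧
    ∀ i, IsOcc S T i → IsGood S y d T i ∨ S.len < i + T.length - 1 + d

/-- `T` is minimally `(y,d)`-unique: it is `(y,d)`-unique, and no proper substring `U = T[i..j]`
of it (the rest of `T` to the right of `U` being `B`, so `|B| = |T| - j`) is `y`-unique with
delay `d + |T| - j`. -/
def IsMinUnique (S : ColoredString α γ) (y : γ) (d : ℕ) (T : List α) : Prop :=
  IsUnique S y d T ∧
    ∀ A U B : List α, T = A ++ U ++ B → U ≠ T → ¬ IsUnique S y (d + B.length) U

end Strings

/-! The suffix tree of the reversed string. A node is identified with the string `L(u)` that it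
represents; `none` plays the role of the end marker `$`. -/

section SuffixTree

/-- Nodes (and loci) of the suffix tree, as strings over the alphabet extended by `$ = none`. -/
abbrev Node (α : Type u) := List (Option α)

variable {α : Type u} {γ : Type v} [DecidableEq α]

/-- The string `S^rev $`. -/
def text (S : ColoredString α γ) : Node α := S.str.reverse.map some ++ [none]

/-- The leaves: the nonempty suffixes of `S^rev $`. -/
def IsLeaf (S : ColoredString α γ) (u : Node α) : Prop := u ≠ [] ∧ u <:+ text S

instance (S : ColoredString α γ) (u : Node α) : Decidable (IsLeaf S u) :=
  inferInstanceAs (Decidable (_ ∧ _))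

/-- The nodes: the root, the leaves, and the right-branching substrings of `S^rev $`. -/
def IsNode (S : ColoredString α γ) (u : Node α) : Prop :=
  u = [] ∨ IsLeaf S u ∨
    ∃ a ∈ text S, ∃ b ∈ text S, a ≠ b ∧ u ++ [a] <:+: text S ∧ u ++ [b] <:+: text S

instance (S : ColoredString α γ) (u : Node α) : Decidable (IsNode S u) :=
  inferInstanceAs (Decidable (_ ∨ _ ∨ _))

/-- The leaf number: the starting position of the suffix `u` in `S^rev $`. -/
def leafNumber (S : ColoredString α γ) (u : Node α) : ℕ := S.len + 2 - u.length

/-- The proper ancestors of `u`, from its parent up to the root. -/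
def ancestors (S : ColoredString α γ) (u : Node α) : List (Node α) :=
  (u.inits.dropLast.filter fun v => decide (IsNode S v)).reverse

/-- The parent; the root has none. -/
def parent (S : ColoredString α γ) (u : Node α) : Option (Node α) := (ancestors S u).head?

/-- The treedepth. -/
def treeDepth (S : ColoredString α γ) (u : Node α) : ℕ := (ancestors S u).length

/-- `ord` lists every node of the suffix tree exactly once, by nondecreasing treedepth. Every
breadth-first traversal does so. -/
structure IsLevelOrder (S : ColoredString α γ) (ord : List (Node α)) : Prop where
  nodup : ord.Nodup
  mem_iff : ∀ u, u ∈ ord ↔ IsNode S u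
  sorted : ord.Pairwise fun u v => treeDepth S u ≤ treeDepth S v

/-- The children of `u`, in the order of the traversal. -/
def children (S : ColoredString α γ) (ord : List (Node α)) (u : Node α) : List (Node α) :=
  ord.filter fun v => decide (parent S v = some u)

/-- The node `u` of the locus `(u,t)` of the string `X`, where `t = |X|`: `X` is a prefix
of `L(u)` but not of `L(parent u)`. -/
def locusNode (S : ColoredString α γ) (ord : List (Node α)) (X : Node α) : Node α :=
  (ord.find? fun u => decide (X <+: u ∧ ∀ p ∈ ancestors S u, p.length < X.length)).getD []

/-- The node `u'` with `(u',t') = slink(u, sd(v) + 1)`, where `v` is the parent of `u`. -/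
def slinkNode (S : ColoredString α γ) (ord : List (Node α)) (u v : Node α) : Node α :=
  locusNode S ord (u.take (v.length + 1)).tail

/-- `Left-min(u) = x₁ · L(v)^rev`, where `v` is the parent of `u` and `x₁` is the first character
of the label of the edge `(v,u)`. It is undefined for the root and for an edge labeled `$`. -/
def leftMin (S : ColoredString α γ) (u : Node α) : Option (List α) :=
  match parent S u with
  | none => none
  | some v => if u = v ++ [none] then none else some (u.take (v.length + 1)).reverse.reduceOption

/-- The reverse breadth-first index of `u`: the number of nodes minus the (1-based) rank. -/
def iBFS (ord : List (Node α)) (u : Node α) : ℕ := ord.length - (ord.idxOf u + 1)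

/-- The node with a given reverse breadth-first index. -/
def nodeOf (ord : List (Node α)) (i : ℕ) : Node α := (ord[ord.length - (i + 1)]?).getD []

/-- Level orders exist. -/
theorem exists_isLevelOrder (S : ColoredString α γ) : ∃ ord, IsLevelOrder S ord := by
  classical
  have hfin : {u | IsNode S u}.Finite := by
    refine (List.finite_toSet (text S).sublists).subset fun u hu => ?_
    have : u <:+: text S := by
      rcases hu with h | h | ⟨a, -, b, -, -, h, -⟩
      · exact h ▸ List.nil_infix
      · exact h.2.isInfix
      · exact ((List.prefix_append u [a]).isInfix).trans h
    exact List.mem_sublists.2 this.sublist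
  let le : Node α → Node α → Bool := fun u v => decide (treeDepth S u ≤ treeDepth S v)
  refine ⟨hfin.toFinset.toList.mergeSort le, ?_, fun u => ?_, ?_⟩
  · exact (List.mergeSort_perm _ _).nodup_iff.2 (Finset.nodup_toList _)
  · simp
  · have := List.pairwise_mergeSort (le := le)
      (fun a b c h1 h2 => by simp only [le, decide_eq_true_eq] at *; omega)
      (fun a b => by simp only [le, Bool.or_eq_true, decide_eq_true_eq]; omega)
      hfin.toFinset.toList
    exact this.imp fun h => by simpa [le] using h

end SuffixTree

/-! The algorithm. It runs on a store of arrays (functions on indices, changed one entry at a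
time). The suffix tree with its suffix links is given: following a pointer from a node to its
index, parent, next child, leaf number or suffix link, reading or writing an array entry, an
arithmetic operation or comparison, and reporting a pair (as a reference to the locus of its
string) are elementary operations. Each `tick` pays for a bounded number of them. -/

section Algorithm

/-- The store. -/
structure Store (α : Type u) where
  /-- priority queue: the key of each index -/
  key : ℕ → ℤ
  /-- priority queue: a tournament tree with root `1`, where `2 * x` and `2 * x + 1` are below `x`;
  it holds at `x` the index with the largest key among the indices inserted below `x` -/
  win : ℕ → Option ℕ
  /-- number of ones of the bitvector strictly before a position -/
  rank : ℕ → ℕ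
  /-- position of the `r`-th one of the bitvector; entry `0` holds `-1` -/
  select : ℕ → ℤ
  /-- number of ones met so far in the preprocessing of the bitvector -/
  ones : ℕ
  /-- for each parity, the last `d` of this parity for which the node was extracted -/
  leftMinimal : ℕ → ℕ → Option ℕ
  /-- the reported pairs -/
  out : List (List α × ℕ)
  /-- number of `demote` operations on each index -/
  demotes : ℕ → ℕ
  /-- number of ancestors that were visited without being demoted -/
  idle : ℕ
  /-- number of steps -/
  time : ℕ

variable {α : Type u} {γ : Type v}

/-- The store before the start. -/
def Store.empty : Store α where
  key := fun _ => 0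
  win := fun _ => none
  rank := fun _ => 0
  select := fun _ => -1
  ones := 0
  leftMinimal := fun _ _ => none
  out := []
  demotes := fun _ => 0
  idle := 0
  time := 0

/-- Pay for one step. -/
def Store.tick (s : Store α) : Store α := { s with time := s.time + 1 }

/-! Maximum-oriented indexed priority queue with `2 ^ L` indices; ties are broken in favor of the
larger index. -/

/-- The winner among two entries of the tournament tree. -/
def better (key : ℕ → ℤ) : Option ℕ → Option ℕ → Option ℕ
  | none, b => b
  | a, none => a
  | some i, some j => if key i < key j ∨ (key i = key j ∧ i < j) then some j else some i

/-- Recompute `l` entries of the tournament tree, from `x` upwards. -/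
def Store.climb : ℕ → ℕ → Store α → Store α
  | 0, _, s => s
  | l + 1, x, s =>
    Store.climb l (x / 2)
      { s.tick with win := Function.update s.win x (better s.key (s.win (2 * x)) (s.win (2 * x + 1))) }

/-- Give index `i` the key `k`. -/
def Store.setKey (L i : ℕ) (k : ℤ) (s : Store α) : Store α :=
  Store.climb L ((2 ^ L + i) / 2)
    { s.tick with
      key := Function.update s.key i k
      win := Function.update s.win (2 ^ L + i) (some i) }

/-- `insert(i,k)` -/
def Store.insert (L i : ℕ) (k : ℤ) (s : Store α) : Store α := s.setKey L i k

/-- `demote(i,k)` -/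
def Store.demote (L i : ℕ) (k : ℤ) (s : Store α) : Store α :=
  { s.setKey L i k with demotes := Function.update s.demotes i (s.demotes i + 1) }

/-- `max()`: the index and the value of the largest key. -/
def Store.max (s : Store α) : Option (ℕ × ℤ) := (s.win 1).map fun i => (i, s.key i)

/-- `allNegative()` -/
def Store.allNegative (s : Store α) : Bool :=
  match s.max with
  | none => true
  | some (_, k) => decide (k < 0)

/-! The bitvector `b_y[1..2n]` with tables for rank and select. -/

/-- `b_y[p] = 1` iff position `p` has color `y` or lies beyond the end of the string. -/
def bit [DecidableEq γ] (S : ColoredString α γ) (y : γ) (p : ℕ) : Bool :=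
  decide (S.colorAt p = some y ∨ S.len < p)

/-- Fill the tables for position `p`, after all smaller positions. -/
def Store.scan [DecidableEq γ] (S : ColoredString α γ) (y : γ) (s : Store α) (p : ℕ) : Store α :=
  if bit S y p then
    { s.tick with
      ones := s.ones + 1
      select := Function.update s.select (s.ones + 1) (p : ℤ)
      rank := Function.update s.rank (p + 1) (s.ones + 1) }
  else
    { s.tick with rank := Function.update s.rank (p + 1) s.ones }

/-- Preprocess the bitvector. -/
def Store.preprocess [DecidableEq γ] (S : ColoredString α γ) (y : γ) (s : Store α) : Store α :=
  (List.range (2 * S.len)).foldl (fun s q => Store.scan S y s (q + 1)) s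

variable [DecidableEq α]

/-- The number of levels of the tournament tree. -/
def levels (ord : List (Node α)) : ℕ := Nat.clog 2 ord.length

/-- The recursive procedure `h(u,ℓ)`: it returns its value and demotes the key of every node in the
subtree of `u` to the value at that node. The first argument bounds the depth of the recursion;
`n + 2` exceeds the height of the suffix tree. -/
def hProc (S : ColoredString α γ) (ord : List (Node α)) :
    ℕ → Node α → ℕ → Store α → ℤ × Store α
  | 0, _, ℓ, s => ((ℓ : ℤ) - 1, s)
  | depth + 1, u, ℓ, s =>
    if IsLeaf S u then
      let j := S.len + 1 - leafNumber S u
      let m := max (s.select (s.rank (j + ℓ)) - (j : ℤ)) (-1)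
      (m, s.tick.demote (levels ord) (iBFS ord u) m)
    else
      let r := (children S ord u).foldl
        (fun (a : ℤ × Store α) v =>
          let b := hProc S ord depth v ℓ a.2.tick
          (if b.1 < a.1 then b.1 else a.1, b.2))
        ((ℓ : ℤ) - 1, s.tick)
      (r.1, r.2.demote (levels ord) (iBFS ord u) r.1)

/-- The loop over the given ancestors, from the parent upwards: those with a key larger than `m`
are demoted to `m`. If `brk` holds, the loop is left at the first ancestor with a key `≤ m`;
otherwise all ancestors are visited. -/
def updateAncestors (ord : List (Node α)) (brk : Bool) (m : ℤ) :
    List (Node α) → Store α → Store α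
  | [], s => s
  | v :: vs, s =>
    if m < s.key (iBFS ord v) then
      updateAncestors ord brk m vs (s.tick.demote (levels ord) (iBFS ord v) m)
    else
      let s' := { s.tick with idle := s.idle + 1 }
      if brk then s' else updateAncestors ord brk m vs s'

/-- Right-minimality check and output for the extracted node `u` and the delay `d`. The check
reads off whether `u'` was extracted with key `d + 1`. -/
def report (S : ColoredString α γ) (ord : List (Node α)) (u : Node α) (d : ℕ) (s : Store α) :
    Store α :=
  match parent S u, leftMin S u with
  | some v, some T =>
    if s.leftMinimal ((d + 1) % 2) (iBFS ord (slinkNode S ord u v)) = some (d + 1) then s.tick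
    else { s.tick with out := (T, d) :: s.out }
  | _, _ => s.tick

/-- Record that `u` was extracted with key `d`. -/
def record (ord : List (Node α)) (u : Node α) (d : ℕ) (s : Store α) : Store α :=
  { s.tick with
    leftMinimal := Function.update s.leftMinimal (d % 2)
      (Function.update (s.leftMinimal (d % 2)) (iBFS ord u) (some d)) }

/-- One iteration of the main loop. -/
def iteration (S : ColoredString α γ) (ord : List (Node α)) (brk : Bool) (s : Store α) : Store α :=
  match s.max with
  | none => s
  | some (i, k) =>
    let u := nodeOf ord i
    let d := k.toNat
    let r := hProc S ord (S.len + 2) u d (record ord u d (report S ord u d s.tick))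
    updateAncestors ord brk r.1 (ancestors S u) r.2

/-- `While S ord brk s t`: the main loop, started in the store `s`, terminates in the store `t`. -/
inductive While (S : ColoredString α γ) (ord : List (Node α)) (brk : Bool) :
    Store α → Store α → Prop
  | done (s : Store α) : s.allNegative = true → While S ord brk s s.tick
  | next (s t : Store α) : s.allNegative = false →
      While S ord brk (iteration S ord brk s.tick) t → While S ord brk s t

/-- The initialization: the bitvector is preprocessed, and every node is inserted with key
`n + 1`. -/
def start [DecidableEq γ] (S : ColoredString α γ) (y : γ) (ord : List (Node α)) : Store α :=
  ord.foldl (fun s u => s.tick.insert (levels ord) (iBFS ord u) ((S.len : ℤ) + 1))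
    (Store.preprocess S y Store.empty)

/-- The skipping algorithm for the colored string `S` and the color `y`, on the suffix tree of
`S^rev` with the nodes numbered along `ord`, terminates in the store `t`. -/
def SkippingEndsIn [DecidableEq γ] (S : ColoredString α γ) (y : γ) (ord : List (Node α))
    (brk : Bool) (t : Store α) : Prop :=
  While S ord brk (start S y ord) t

end Algorithm

end ColoredStrings

set_option linter.unusedSectionVars false

namespace ColoredStrings

universe u v

/-! ### Strings as loci of the suffix tree: leaves, loci, ancestors, indices. -/

section Tree

variable {α : Type u} {γ : Type v} [DecidableEq α]

/-! Reversal turns occurrences into leaves: `T` ends at position `j` exactly when the leaf of the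
prefix of length `j` lies below the reversal of `T`. So (`isUnique_iff`) uniqueness with delay `d`
says that bit `j + d` is set for every such `j`, and it depends only on the node of the locus
(`IsLocus.nodeUnique_iff`). Uniqueness survives extension on either side once the delay is adjusted,
so minimality has to be tested only against the two one-letter deletions. Deleting the first letter
of `T` cuts the last letter of its reversal; if uniqueness is lost there, the cut string must be the
parent of the locus, so `T` is `leftMin` of a left-minimal node. Deleting the last letter of `T`
follows a suffix link and raises the delay by one. This gives `isMinUnique_iff_exists`, a criterion
purely in terms of left-minimal nodes.

It remains to see that the loop extracts exactly the left-minimal pairs. The invariant `Inv` says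
that keys do not decrease down the tree, that a nonnegative key of a leaf points at a set bit, and
(`closed`) that no ancestor drops below a delay at which it is unique while some descendant is still
at or above that delay. Let `u` be extracted with the maximal key `d`. All nodes below `u` then have
key `d`, so all their leaves have the right bit and `u` is unique; the tie-breaking makes the keys
of all proper ancestors smaller than `d`, so by `closed` none of them is unique. Hence `(u,d)` is
left-minimal. The recursion lowers keys only to values that skip no smaller unique delay, so exactly
this one left-minimal pair becomes done (`inv_of_iterationSpec`). When all keys are negative, every
left-minimal pair is done. Since extracted keys never increase, the table kept by parity answers the
right-minimality check.

For the cost, number of demotions plus key never increases at a node. It starts at `n + 1` and keys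
are at least `-1`, so each node is demoted at most `n + 2` times; each iteration demotes its
extracted node, whence termination (`exists_while`). A demotion pays for its own climb in the
tournament tree and for a bounded number of further steps (`Evolves`). There are linearly many nodes
(`length_le_of_isLevelOrder`), so `steps_bound` gives the rate. With early stopping there is at most
one idle visit per iteration, hence no more of them than demotions. -/

theorem isLeaf_iff (S : ColoredString α γ) (w : Node α) :
    IsLeaf S w ↔ ∃ j ≤ S.len, w = (S.str.take j).reverse.map some ++ [none] := by
  unfold IsLeaf text
  rw [List.suffix_concat_iff]
  constructor
  · rintro ⟨h0, h | ⟨t, rfl, ht⟩⟩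
    · exact absurd h h0
    · rw [List.suffix_map_iff] at ht
      obtain ⟨t', ht', rfl⟩ := ht
      rw [← List.reverse_prefix, List.reverse_reverse] at ht'
      refine ⟨t'.length, by simpa [ColoredString.len] using ht'.length_le, ?_⟩
      have := List.prefix_iff_eq_take.1 ht'
      rw [List.length_reverse] at this
      rw [← this, List.reverse_reverse]
  · rintro ⟨j, -, rfl⟩
    refine ⟨by simp, Or.inr ⟨_, rfl, ?_⟩⟩
    rw [List.suffix_map_iff]
    exact ⟨_, by rw [List.reverse_suffix]; exact List.take_prefix _ _, rfl⟩

theorem IsLeaf.length_le {S : ColoredString α γ} {w : Node α} (h : IsLeaf S w) :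
    w.length ≤ S.len + 1 := by
  have := h.2.length_le
  simpa [text, ColoredString.len] using this

theorem IsLeaf.length_pos {S : ColoredString α γ} {w : Node α} (h : IsLeaf S w) :
    0 < w.length := List.length_pos_iff.2 h.1

theorem IsLeaf.isNode {S : ColoredString α γ} {w : Node α} (h : IsLeaf S w) : IsNode S w :=
  Or.inr (Or.inl h)

theorem isNode_nil (S : ColoredString α γ) : IsNode S ([] : Node α) := Or.inl rfl

theorem IsNode.infix_text {S : ColoredString α γ} {w : Node α} (h : IsNode S w) :
    w <:+: text S := by
  rcases h with h | h | ⟨a, -, b, -, -, h, -⟩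
  · exact h ▸ List.nil_infix
  · exact h.2.isInfix
  · exact ((List.prefix_append w [a]).isInfix).trans h

theorem IsNode.length_le {S : ColoredString α γ} {w : Node α} (h : IsNode S w) :
    w.length ≤ S.len + 1 := by
  have := h.infix_text.length_le
  simpa [text, ColoredString.len] using this

/-- The end marker occurs only at the end of the text. -/
theorem eq_nil_of_none_append {S : ColoredString α γ} {p t : Node α}
    (h : p ++ none :: t <:+: text S) : t = [] := by
  obtain ⟨a, b, h⟩ := h
  rcases List.eq_nil_or_concat (t ++ b) with h' | ⟨q, x, h'⟩
  · exact (List.append_eq_nil_iff.1 h').1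
  · exfalso
    have h2 : (a ++ p ++ none :: q) ++ [x] = S.str.reverse.map some ++ [none] := by
      rw [← text, ← h]
      simp only [List.append_assoc, List.cons_append, h', List.concat_eq_append]
    have h3 := (List.append_inj' h2 rfl).1
    have : (none : Option α) ∈ S.str.reverse.map some := by rw [← h3]; simp
    simp at this

/-- A leaf ends with the end marker, after which the text cannot continue. -/
theorem IsLeaf.eq_of_prefix {S : ColoredString α γ} {w v : Node α} (h : IsLeaf S w)
    (hv : v <:+: text S) (hp : w <+: v) : v = w := by
  obtain ⟨j, -, rfl⟩ := (isLeaf_iff S w).1 h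
  obtain ⟨t, rfl⟩ := hp
  have : t = [] := by
    refine eq_nil_of_none_append (S := S) (p := (S.str.take j).reverse.map some) ?_
    simpa using hv
  simp [this]

/-- A substring of the text that is properly extended to the right has no end marker. -/
theorem exists_map_some {S : ColoredString α γ} {X t : Node α} (h : X ++ t <:+: text S)
    (ht : t ≠ []) : ∃ Z : List α, X = Z.map some := by
  have hn : none ∉ X := by
    intro hx
    obtain ⟨p, q, rfl⟩ := List.append_of_mem hx
    have := eq_nil_of_none_append (S := S) (p := p) (t := q ++ t) (by simpa using h)
    simp_all
  refine ⟨X.reduceOption, ?_⟩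
  clear h
  induction X with
  | nil => rfl
  | cons a X ih =>
    cases a with
    | none => simp at hn
    | some a =>
      rw [List.reduceOption_cons_of_some, List.map_cons, ← ih fun h => hn (List.mem_cons_of_mem _ h)]

theorem exists_leaf_of_infix {S : ColoredString α γ} {X : Node α} (h : X <:+: text S) :
    ∃ w, IsLeaf S w ∧ X <+: w := by
  obtain ⟨p, q, h⟩ := h
  by_cases hX : X = []
  · subst hX
    exact ⟨text S, ⟨by simp [text], List.suffix_refl _⟩, List.nil_prefix⟩
  · exact ⟨X ++ q, ⟨by simp [hX], ⟨p, by rw [← h, List.append_assoc]⟩⟩, List.prefix_append _ _⟩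

theorem exists_lcp {β : Type*} : ∀ u w : List β, ¬ u <+: w → ¬ w <+: u →
    ∃ (z : List β) (a b : β), a ≠ b ∧ z ++ [a] <+: u ∧ z ++ [b] <+: w
  | [], w, h, _ => absurd List.nil_prefix h
  | u, [], _, h => absurd List.nil_prefix h
  | a :: u, b :: w, h1, h2 => by
    by_cases hab : a = b
    · subst hab
      obtain ⟨z, c, d, hcd, hc, hd⟩ := exists_lcp u w
        (fun h => h1 (by simpa using h)) (fun h => h2 (by simpa using h))
      exact ⟨a :: z, c, d, hcd, by simpa using hc, by simpa using hd⟩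
    · exact ⟨[], a, b, hab, by simp, by simp⟩

/-- `u` is the node of the locus of `X`. -/
structure IsLocus (S : ColoredString α γ) (X u : Node α) : Prop where
  isNode : IsNode S u
  isPrefix : X <+: u
  lt : ∀ p, IsNode S p → p <+: u → p ≠ u → p.length < X.length

/-- If the leaf `w` left the path to `u`, the point of divergence would be a branching node properly
above `u`, hence shorter than `X`. Then `X` itself would already disagree with `w`. Thus the same
leaves lie below `X` and below `u`. -/
theorem IsLocus.prefix_leaf {S : ColoredString α γ} {X u w : Node α} (h : IsLocus S X u)
    (hw : IsLeaf S w) (hX : X <+: w) : u <+: w := by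
  by_contra hu
  by_cases hwu : w <+: u
  · exact hu (hw.eq_of_prefix h.isNode.infix_text hwu ▸ List.prefix_rfl)
  · obtain ⟨z, a, b, hab, ha, hb⟩ := exists_lcp u w hu hwu
    have hzu : z <+: u := (List.prefix_append z [a]).trans ha
    have hzw : z <+: w := (List.prefix_append z [b]).trans hb
    have ha' := ha.isInfix.trans h.isNode.infix_text
    have hb' := hb.isInfix.trans hw.2.isInfix
    have hz : IsNode S z := Or.inr (Or.inr ⟨a, ha'.subset (by simp), b, hb'.subset (by simp), hab,
      ha', hb'⟩)
    have hne : z ≠ u := by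
      rintro rfl
      have := ha.length_le
      simp at this
    have hlt := h.lt z hz hzu hne
    have : z ++ [a] <+: X := List.prefix_of_prefix_length_le ha h.isPrefix (by simpa using hlt)
    have : z ++ [a] <+: w := this.trans hX
    have h3 := List.prefix_of_prefix_length_le this hb (by simp)
    have h4 := h3.eq_of_length (by simp)
    simp at h4
    exact hab h4

theorem exists_isLocus {S : ColoredString α γ} {X : Node α} (h : X <:+: text S) :
    ∃ u, IsLocus S X u := by
  classical
  obtain ⟨w, hw, hX⟩ := exists_leaf_of_infix h
  have hex : ∃ n, ∃ u, IsNode S u ∧ X <+: u ∧ u.length = n := ⟨_, w, hw.isNode, hX, rfl⟩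
  obtain ⟨u, hu, hXu, hl⟩ := Nat.find_spec hex
  refine ⟨u, hu, hXu, fun p hp hpu hne => ?_⟩
  by_contra hlt
  have hXp : X <+: p := List.prefix_of_prefix_length_le hXu hpu (by omega)
  have := Nat.find_min' hex ⟨p, hp, hXp, rfl⟩
  rw [← hl] at this
  exact hne (hpu.eq_of_length_le this)

theorem IsLocus.unique {S : ColoredString α γ} {X u w : Node α} (h : IsLocus S X u)
    (h' : IsLocus S X w) : u = w := by
  obtain ⟨l, hl, hwl⟩ := exists_leaf_of_infix h'.isNode.infix_text
  have hul := h.prefix_leaf hl (h'.isPrefix.trans hwl)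
  by_contra hne
  rcases List.prefix_or_prefix_of_prefix hul hwl with h1 | h1
  · have := h'.lt u h.isNode h1 hne
    have := h.isPrefix.length_le
    omega
  · have := h.lt w h'.isNode h1 (Ne.symm hne)
    have := h'.isPrefix.length_le
    omega

/-! Ancestors, parents, children, treedepth. -/

theorem ancestors_nil (S : ColoredString α γ) : ancestors S ([] : Node α) = [] := by
  simp [ancestors]

theorem ancestors_concat (S : ColoredString α γ) (w : Node α) (a : Option α) :
    ancestors S (w ++ [a]) = if IsNode S w then w :: ancestors S w else ancestors S w := by
  have h1 : (w ++ [a]).inits.dropLast = w.inits.dropLast ++ [w] := by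
    have hl : ∀ l : Node α, l.inits = l.inits.dropLast ++ [l] := by
      intro l
      have := List.dropLast_append_getLast (l := l.inits)
        (List.ne_nil_of_length_pos (by simp))
      conv_lhs => rw [← this]
      simp [List.getLast_eq_getElem]
    rw [List.inits_append]
    simp only [List.inits, List.map, List.tail]
    rw [List.dropLast_concat]
    exact hl w
  unfold ancestors
  rw [h1, List.filter_append, List.reverse_append]
  by_cases h : IsNode S w <;> simp [h]

theorem mem_ancestors {S : ColoredString α γ} {u p : Node α} :
    p ∈ ancestors S u ↔ IsNode S p ∧ p <+: u ∧ p ≠ u := by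
  induction u using List.reverseRecOn with
  | nil => simp +contextual [ancestors_nil]
  | append_singleton w a ih =>
    rw [ancestors_concat]
    have : p <+: w ++ [a] ∧ p ≠ w ++ [a] ↔ p <+: w := by
      rw [List.prefix_concat_iff]
      constructor
      · rintro ⟨h | h, h'⟩
        · exact absurd h h'
        · exact h
      · intro h
        refine ⟨Or.inr h, ?_⟩
        rintro rfl
        have := h.length_le
        simp at this
    rw [this]
    split_ifs with h
    · rw [List.mem_cons, ih]
      constructor
      · rintro (rfl | h')
        · exact ⟨h, List.prefix_rfl⟩
        · exact ⟨h'.1, h'.2.1⟩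
      · rintro ⟨h1, h2⟩
        by_cases hp : p = w
        · exact Or.inl hp
        · exact Or.inr ⟨h1, h2, hp⟩
    · rw [ih]
      constructor
      · rintro ⟨h1, h2, -⟩; exact ⟨h1, h2⟩
      · rintro ⟨h1, h2⟩; exact ⟨h1, h2, fun hp => h (hp ▸ h1)⟩

theorem pairwise_ancestors (S : ColoredString α γ) (u : Node α) :
    (ancestors S u).Pairwise fun p q => q <+: p ∧ q ≠ p := by
  induction u using List.reverseRecOn with
  | nil => simp [ancestors_nil]
  | append_singleton w a ih =>
    rw [ancestors_concat]
    split_ifs with h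
    · exact List.pairwise_cons.2 ⟨fun q hq => (mem_ancestors.1 hq).2, ih⟩
    · exact ih

theorem treeDepth_lt {S : ColoredString α γ} {w u : Node α} (hw : IsNode S w) (h : w <+: u)
    (hne : w ≠ u) : treeDepth S w < treeDepth S u := by
  induction u using List.reverseRecOn with
  | nil => exact absurd (List.prefix_nil.1 h) hne
  | append_singleton x a ih =>
    unfold treeDepth at *
    rw [ancestors_concat]
    rw [List.prefix_concat_iff] at h
    rcases h with h | h
    · exact absurd h hne
    · by_cases hx : w = x
      · subst hx; simp [hw]
      · have := ih h hx
        split_ifs <;> simp <;> omega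

/-- The list of ancestors runs from long to short prefixes, so its head is the longest proper prefix
that is a node. -/
theorem parent_eq_some {S : ColoredString α γ} {u v : Node α} :
    parent S u = some v ↔ (IsNode S v ∧ v <+: u ∧ v ≠ u) ∧
      ∀ p, IsNode S p → p <+: u → p ≠ u → p <+: v := by
  unfold parent
  have hp := pairwise_ancestors S u
  have hm := @mem_ancestors _ _ _ S u
  cases h : ancestors S u with
  | nil =>
    simp only [List.head?_nil, reduceCtorEq, false_iff]
    rintro ⟨h1, -⟩
    have := hm.2 h1
    simp [h] at this
  | cons a l =>
    rw [h] at hp hm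
    rw [List.pairwise_cons] at hp
    simp only [List.head?_cons, Option.some.injEq]
    constructor
    · rintro rfl
      refine ⟨hm.1 (by simp), fun p h1 h2 h3 => ?_⟩
      rcases List.mem_cons.1 (hm.2 ⟨h1, h2, h3⟩) with rfl | h4
      · exact List.prefix_rfl
      · exact (hp.1 p h4).1
    · rintro ⟨h1, h2⟩
      rcases List.mem_cons.1 (hm.2 h1) with rfl | h4
      · rfl
      · have h5 := hm.1 (List.mem_cons_self (a := a) (l := l))
        have h6 := h2 a h5.1 h5.2.1 h5.2.2
        have h7 := (hp.1 v h4)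
        exact h6.eq_of_length_le h7.1.length_le

theorem exists_parent {S : ColoredString α γ} {u : Node α} (h : u ≠ []) :
    ∃ v, parent S u = some v := by
  unfold parent
  have := (mem_ancestors (S := S) (u := u) (p := [])).2 ⟨isNode_nil S, List.nil_prefix, h.symm⟩
  cases h' : ancestors S u with
  | nil => simp [h'] at this
  | cons a l => exact ⟨a, rfl⟩

variable {S : ColoredString α γ} {ord : List (Node α)}

theorem mem_children (ho : IsLevelOrder S ord) {u v : Node α} :
    v ∈ children S ord u ↔ IsNode S v ∧ parent S v = some u := by
  simp [children, ho.mem_iff]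

theorem nodup_children (ho : IsLevelOrder S ord) (u : Node α) : (children S ord u).Nodup :=
  ho.nodup.filter _

/-- Every proper descendant lies below a child. -/
theorem exists_child (ho : IsLevelOrder S ord) {u w : Node α} (hu : IsNode S u)
    (hw : IsNode S w) (h : u <+: w) (hne : u ≠ w) : ∃ v ∈ children S ord u, v <+: w := by
  classical
  -- The child is the shortest node on the path to `w` that is longer than `u`.
  have hex : ∃ n, ∃ v, IsNode S v ∧ v <+: w ∧ u.length < v.length ∧ v.length = n :=
    ⟨_, w, hw, List.prefix_rfl, lt_of_le_of_ne h.length_le fun hl => hne (h.eq_of_length hl), rfl⟩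
  obtain ⟨v, hv, hvw, hlt, hl⟩ := Nat.find_spec hex
  refine ⟨v, (mem_children ho).2 ⟨hv, parent_eq_some.2 ⟨⟨hu, ?_, ?_⟩, fun p hp hpv hpn => ?_⟩⟩, hvw⟩
  · exact List.prefix_of_prefix_length_le h hvw hlt.le
  · rintro rfl; omega
  · refine List.prefix_of_prefix_length_le (hpv.trans hvw) h ?_
    by_contra hc
    have := Nat.find_min' hex ⟨p, hp, hpv.trans hvw, by omega, rfl⟩
    rw [← hl] at this
    exact hpn (hpv.eq_of_length_le this)

theorem child_prefix (ho : IsLevelOrder S ord) {u v : Node α} (h : v ∈ children S ord u) :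
    IsNode S v ∧ u <+: v ∧ u ≠ v := by
  have h1 := (mem_children ho).1 h
  exact ⟨h1.1, (parent_eq_some.1 h1.2).1.2⟩

/-- Subtrees of different children are disjoint. -/
theorem child_unique (ho : IsLevelOrder S ord) {u v v' w : Node α} (h : v ∈ children S ord u)
    (h' : v' ∈ children S ord u) (hw : v <+: w) (hw' : v' <+: w) : v = v' := by
  have h1 := (mem_children ho).1 h
  have h2 := (mem_children ho).1 h'
  have key : ∀ {a b : Node α}, IsNode S a → parent S a = some u → parent S b = some u →
      a <+: b → a = b := by
    intro a b ha hpa hpb hab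
    by_contra hne
    have h3 := (parent_eq_some.1 hpb).2 a ha hab hne
    have h4 := (parent_eq_some.1 hpa).1
    exact h4.2.2 (h4.2.1.eq_of_length_le h3.length_le)
  rcases List.prefix_or_prefix_of_prefix hw hw' with h3 | h3
  · exact key h1.1 h1.2 h2.2 h3
  · exact (key h2.1 h2.2 h1.2 h3).symm

theorem isLocus_locusNode (ho : IsLevelOrder S ord) {X : Node α} (h : X <:+: text S) :
    IsLocus S X (locusNode S ord X) := by
  obtain ⟨u, hu⟩ := exists_isLocus h
  unfold locusNode
  have key : ∀ w ∈ ord, (decide (X <+: w ∧ ∀ p ∈ ancestors S w, p.length < X.length) = true ↔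
      IsLocus S X w) := by
    intro w hw
    rw [decide_eq_true_eq]
    constructor
    · rintro ⟨h1, h2⟩
      exact ⟨(ho.mem_iff w).1 hw, h1, fun p hp h3 h4 => h2 p (mem_ancestors.2 ⟨hp, h3, h4⟩)⟩
    · intro h1
      refine ⟨h1.isPrefix, fun p hp => ?_⟩
      have := mem_ancestors.1 hp
      exact h1.lt p this.1 this.2.1 this.2.2
  cases hf : ord.find? fun u => decide (X <+: u ∧ ∀ p ∈ ancestors S u, p.length < X.length) with
  | none =>
    rw [List.find?_eq_none] at hf
    have hm := (ho.mem_iff u).2 hu.isNode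
    exact absurd ((key u hm).2 hu) (hf u hm)
  | some w =>
    have h1 := List.find?_some hf
    exact (key w (List.mem_of_find?_eq_some hf)).1 h1

theorem iBFS_lt {u : Node α} (h : u ∈ ord) : iBFS ord u < ord.length := by
  have := List.idxOf_lt_length_of_mem h
  unfold iBFS; omega

theorem iBFS_inj {u w : Node α} (hu : u ∈ ord) (hw : w ∈ ord) (h : iBFS ord u = iBFS ord w) :
    u = w := by
  have h1 := List.idxOf_lt_length_of_mem hu
  have h2 := List.idxOf_lt_length_of_mem hw
  unfold iBFS at h
  have : ord.idxOf u = ord.idxOf w := by omega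
  exact (List.idxOf_inj hu).1 this

theorem nodeOf_spec (ho : ord.Nodup) {i : ℕ} (h : i < ord.length) :
    nodeOf ord i ∈ ord ∧ iBFS ord (nodeOf ord i) = i := by
  have hl : ord.length - (i + 1) < ord.length := by omega
  have h1 : nodeOf ord i = ord[ord.length - (i + 1)] := by
    simp [nodeOf, List.getElem?_eq_getElem hl]
  rw [h1]
  refine ⟨List.getElem_mem _, ?_⟩
  unfold iBFS
  rw [ho.idxOf_getElem]
  omega

/-- A proper ancestor has smaller treedepth, is listed earlier, and so gets the larger reversed
index. Breaking ties by larger index therefore prefers ancestors. -/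
theorem iBFS_lt_of_prefix (ho : IsLevelOrder S ord) {w u : Node α} (hw : IsNode S w)
    (hu : IsNode S u) (h : w <+: u) (hne : w ≠ u) : iBFS ord u < iBFS ord w := by
  have h1 := List.idxOf_lt_length_of_mem ((ho.mem_iff w).2 hw)
  have h2 := List.idxOf_lt_length_of_mem ((ho.mem_iff u).2 hu)
  have h3 := treeDepth_lt hw h hne
  have h4 : ord.idxOf w < ord.idxOf u := by
    by_contra hc
    rcases (not_lt.1 hc).lt_or_eq with hc | hc
    · have := List.pairwise_iff_getElem.1 ho.sorted _ _ h2 h1 hc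
      simp only [List.getElem_idxOf] at this
      omega
    · exact hne ((List.idxOf_inj ((ho.mem_iff u).2 hu)).1 hc).symm
  unfold iBFS
  omega

end Tree

/-! ### Uniqueness and minimality expressed in the suffix tree. -/

section Unique

variable {α : Type u} {γ : Type v} [DecidableEq α] [DecidableEq γ]

/-- The bit of `b_y` with delay `d` is set for every leaf below the string `X`. -/
def NodeUnique (S : ColoredString α γ) (y : γ) (d : ℕ) (X : Node α) : Prop :=
  ∀ w, IsLeaf S w → X <+: w → bit S y (w.length - 1 + d) = true

/-- `u` is unique, and none of its proper ancestors is. -/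
def LeftMinimal (S : ColoredString α γ) (y : γ) (d : ℕ) (u : Node α) : Prop :=
  NodeUnique S y d u ∧ ∀ p, IsNode S p → p <+: u → p ≠ u → ¬ NodeUnique S y d p

variable {S : ColoredString α γ} {y : γ}

theorem NodeUnique.of_prefix {d : ℕ} {X Y : Node α} (h : NodeUnique S y d X) (hXY : X <+: Y) :
    NodeUnique S y d Y :=
  fun w hw hY => h w hw (hXY.trans hY)

theorem IsLocus.nodeUnique_iff {d : ℕ} {X u : Node α} (h : IsLocus S X u) :
    NodeUnique S y d u ↔ NodeUnique S y d X :=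
  ⟨fun hu w hw hX => hu w hw (h.prefix_leaf hw hX), fun hX => hX.of_prefix h.isPrefix⟩

theorem nodeUnique_of_len_lt {d : ℕ} (h : S.len < d) (X : Node α) : NodeUnique S y d X := by
  intro w _ _
  have : S.len < w.length - 1 + d := by omega
  simp [bit, this]

/-- Removing the first letter of a leaf below `a :: X` gives the leaf of a prefix shorter by one
below `X`. The larger delay compensates, so both look at the same bit. This is the effect of a
suffix link. -/
theorem NodeUnique.cons {d : ℕ} {X : Node α} (a : α) (h : NodeUnique S y (d + 1) X) :
    NodeUnique S y d (some a :: X) := by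
  intro w hw hX
  obtain ⟨t, rfl⟩ := hX
  have hlen : 0 < (X ++ t).length := by
    by_contra h0
    have h1 : X ++ t = [] := List.length_eq_zero_iff.1 (by omega)
    obtain ⟨j, -, hj⟩ := (isLeaf_iff S _).1 hw
    rw [List.cons_append, h1] at hj
    have := List.append_inj' (s₁ := []) (t₁ := [some a]) hj rfl
    simp at this
  have hl : IsLeaf S (X ++ t) :=
    ⟨List.length_pos_iff.1 hlen, (List.suffix_cons (some a) (X ++ t)).trans hw.2⟩
  have := h _ hl (List.prefix_append _ _)
  rw [List.cons_append, List.length_cons]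
  convert this using 2
  omega

theorem NodeUnique.append_left {d : ℕ} {X : Node α} (B : List α)
    (h : NodeUnique S y (d + B.length) X) : NodeUnique S y d (B.map some ++ X) := by
  induction B generalizing d with
  | nil => simpa using h
  | cons b B ih =>
    exact NodeUnique.cons b (ih (by rwa [List.length_cons, ← add_assoc, add_right_comm] at h))

/-- The text contains the reversal of every substring. -/
theorem infix_text_of_infix {T : List α} (h : T <:+: S.str) :
    T.reverse.map some <:+: text S := by
  have h1 : T.reverse.map some <:+: S.str.reverse.map some :=
    (List.reverse_infix.2 h).map some
  exact h1.trans (List.prefix_append _ _).isInfix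

theorem infix_of_infix_text {Z : List α} (h : Z.map some <:+: text S) :
    Z.reverse <:+: S.str := by
  obtain ⟨w, hw, hZ⟩ := exists_leaf_of_infix h
  obtain ⟨j, -, rfl⟩ := (isLeaf_iff S w).1 hw
  have h1 : Z.map some <+: (S.str.take j).reverse.map some := by
    rw [List.prefix_concat_iff] at hZ
    rcases hZ with hZ | hZ
    · exfalso
      have : (none : Option α) ∈ Z.map some := by rw [hZ]; simp
      simp at this
    · exact hZ
  rw [List.prefix_map_iff_of_injective (Option.some_injective α)] at h1
  have h2 : Z.reverse <:+ S.str.take j := by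
    rw [← List.reverse_suffix, List.reverse_reverse] at h1
    exact h1
  exact h2.isInfix.trans (List.take_prefix _ _).isInfix

/-- An occurrence `i` corresponds to the leaf of the prefix of length `j = i + |T| - 1`, because `T`
is a suffix of that prefix. The leaf has length `j + 1`, which explains the `- 1` in `NodeUnique`.
-/
theorem isUnique_iff {d : ℕ} {T : List α} (hT : T <:+: S.str) :
    IsUnique S y d T ↔ NodeUnique S y d (T.reverse.map some) := by
  have key : ∀ j ≤ S.len, T.reverse.map some <+: (S.str.take j).reverse.map some ++ [none] ↔
      T <:+ S.str.take j := by
    intro j _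
    rw [List.prefix_concat_iff, List.prefix_map_iff_of_injective (Option.some_injective α),
      List.reverse_prefix]
    refine or_iff_right fun h => ?_
    have : (none : Option α) ∈ T.reverse.map some := by rw [h]; simp
    simp at this
  have hl : ∀ j ≤ S.len, ((S.str.take j).reverse.map some ++ [(none : Option α)]).length - 1 = j := by
    intro j hj
    have : j ≤ S.str.length := hj
    simp [this]
  constructor
  · rintro ⟨-, h⟩ w hw hp
    obtain ⟨j, hj, rfl⟩ := (isLeaf_iff S w).1 hw
    rw [hl j hj]
    have hj' : j ≤ S.str.length := hj
    have h1 := (key j hj).1 hp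
    have h2 := h1.length_le
    rw [List.length_take, min_eq_left hj'] at h2
    have h3 := List.suffix_iff_eq_drop.1 h1
    rw [List.length_take, min_eq_left hj', List.drop_take,
      show j - (j - T.length) = T.length by omega] at h3
    have h4 := h (j - T.length + 1) ⟨by omega, by omega, by simpa using h3.symm⟩
    unfold IsGood at h4
    rw [show j - T.length + 1 + T.length - 1 + d = j + d by omega] at h4
    simpa [bit] using h4
  · refine fun h => ⟨hT, fun i hi => ?_⟩
    obtain ⟨hi1, hi2, hi3⟩ := hi
    have hj : i + T.length - 1 ≤ S.len := by omega
    have hj' : i + T.length - 1 ≤ S.str.length := hj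
    have hw := (isLeaf_iff S _).2 ⟨_, hj, rfl⟩
    have h1 : T <:+ S.str.take (i + T.length - 1) := by
      rw [List.suffix_iff_eq_drop, List.length_take, min_eq_left hj', List.drop_take]
      rw [show i + T.length - 1 - T.length = i - 1 by omega,
        show i + T.length - 1 - (i - 1) = T.length by omega]
      exact hi3.symm
    have h2 := h _ hw ((key _ hj).2 h1)
    rw [hl _ hj] at h2
    simpa [bit, IsGood] using h2

theorem IsUnique.extend {d : ℕ} {A U B : List α} (hT : A ++ U ++ B <:+: S.str)
    (h : IsUnique S y (d + B.length) U) : IsUnique S y d (A ++ U ++ B) := by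
  rw [isUnique_iff hT]
  rw [isUnique_iff h.1] at h
  have h1 := NodeUnique.append_left B.reverse (d := d) (by simpa using h)
  refine h1.of_prefix ⟨A.reverse.map some, ?_⟩
  simp

/-- A proper substring misses the first or the last letter of `T`, so `IsUnique.extend` carries its
uniqueness to `T.tail` or to `T.dropLast`. -/
theorem isMinUnique_iff {d : ℕ} {T : List α} (hT : T ≠ []) :
    IsMinUnique S y d T ↔ IsUnique S y d T ∧ ¬ IsUnique S y d T.tail ∧
      ¬ IsUnique S y (d + 1) T.dropLast := by
  constructor
  · rintro ⟨h, h1⟩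
    refine ⟨h, ?_, ?_⟩
    · have := h1 [T.head hT] T.tail [] (by simp) ?_
      · simpa using this
      · intro h2
        have := congrArg List.length h2
        have := List.length_pos_iff.2 hT
        simp at *; omega
    · have := h1 [] T.dropLast [T.getLast hT]
        (by rw [List.nil_append, List.dropLast_append_getLast]) ?_
      · simpa using this
      · intro h2
        have := congrArg List.length h2
        have := List.length_pos_iff.2 hT
        simp at *; omega
  · rintro ⟨h, h1, h2⟩
    refine ⟨h, fun A U B hAB hU hu => ?_⟩
    rcases A with _ | ⟨a, A⟩
    · rcases List.eq_nil_or_concat B with rfl | ⟨B', b, rfl⟩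
      · simp at hAB; exact hU hAB.symm
      · apply h2
        have h3 : T.dropLast = [] ++ U ++ B' := by
          rw [hAB, List.concat_eq_append, ← List.append_assoc, List.dropLast_concat]
        rw [h3]
        refine IsUnique.extend ?_ (by convert hu using 1; simp; omega)
        rw [← h3]
        exact (List.dropLast_prefix T).isInfix.trans h.1
    · apply h1
      have h3 : T.tail = A ++ U ++ B := by rw [hAB]; rfl
      rw [h3]
      refine IsUnique.extend ?_ hu
      rw [← h3]
      exact (List.tail_suffix T).isInfix.trans h.1

theorem reduceOption_map_some (Z : List α) : (Z.map some).reduceOption = Z := by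
  simp [List.reduceOption]

/-- `reduceOption` would silently delete an end marker. None is present: either the prefix taken is
proper in `u`, or the edge label is a single letter, which is not the marker where `leftMin` is
defined. -/
theorem leftMin_eq_some {u : Node α} {T : List α} (hu : IsNode S u) :
    leftMin S u = some T ↔ ∃ v, parent S u = some v ∧ T ≠ [] ∧
      u.take (v.length + 1) = T.reverse.map some := by
  unfold leftMin
  cases hp : parent S u with
  | none => simp
  | some v =>
    obtain ⟨⟨hv, hvu, hne⟩, -⟩ := parent_eq_some.1 hp
    have hlt : v.length < u.length :=
      lt_of_le_of_ne hvu.length_le fun hl => hne (hvu.eq_of_length hl)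
    simp only [Option.some.injEq, exists_eq_left']
    split_ifs with h
    · simp only [false_iff, not_and]
      rintro - hc
      have : (none : Option α) ∈ T.reverse.map some := by
        rw [← hc, h, List.take_of_length_le (by simp)]; simp
      simp at this
    · obtain ⟨t, ht⟩ := List.take_prefix (v.length + 1) u
      obtain ⟨Z, hZ⟩ : ∃ Z : List α, u.take (v.length + 1) = Z.map some := by
        by_cases ht0 : t = []
        · obtain ⟨s, rfl⟩ := hvu
          subst ht0
          have hl : s.length = 1 := by
            have := congrArg List.length ht
            simp at this hlt
            omega
          obtain ⟨a, rfl⟩ := List.length_eq_one_iff.1 hl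
          obtain ⟨Z, rfl⟩ := exists_map_some hu.infix_text (by simp)
          cases a with
          | none => exact absurd rfl h
          | some a => exact ⟨Z ++ [a], by simp⟩
        · exact exists_map_some (t := t) (by rw [ht]; exact hu.infix_text) ht0
      have hZ0 : Z ≠ [] := by
        rintro rfl
        have := congrArg List.length hZ
        rw [List.length_take, List.map_nil, List.length_nil] at this
        omega
      rw [hZ, ← List.map_reverse, reduceOption_map_some, Option.some.injEq]
      constructor
      · rintro rfl
        simp [hZ0]
      · rintro ⟨-, h2⟩
        rw [(List.map_injective_iff.2 (Option.some_injective α)) h2, List.reverse_reverse]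

/-- The minimally unique strings are the strings `leftMin u` of the left-minimal nodes `u` whose
suffix link does not lead to a left-minimal node with delay `d + 1`. -/
theorem isMinUnique_iff_exists {ord : List (Node α)} (ho : IsLevelOrder S ord) {d : ℕ}
    {T : List α} :
    T ≠ [] ∧ d ≤ S.len ∧ IsMinUnique S y d T ↔
      ∃ u v, IsNode S u ∧ parent S u = some v ∧ LeftMinimal S y d u ∧ leftMin S u = some T ∧
        ¬ LeftMinimal S y (d + 1) (slinkNode S ord u v) := by
  constructor
  · rintro ⟨hT, -, hm⟩
    obtain ⟨h1, h2, h3⟩ := (isMinUnique_iff hT).1 hm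
    have hTl : T.tail <:+: S.str := (List.tail_suffix T).isInfix.trans h1.1
    have hTd : T.dropLast <:+: S.str := (List.dropLast_prefix T).isInfix.trans h1.1
    rw [isUnique_iff h1.1] at h1
    rw [isUnique_iff hTl] at h2
    rw [isUnique_iff hTd] at h3
    have hXi := infix_text_of_infix hm.1.1
    set X : Node α := T.reverse.map some with hX
    have hX0 : X ≠ [] := by simp [hX, hT]
    have hXl : 0 < X.length := List.length_pos_iff.2 hX0
    have hY : T.tail.reverse.map some = X.dropLast := by
      rw [hX, ← List.map_dropLast, List.dropLast_reverse]
    have hY2 : T.dropLast.reverse.map some = X.tail := by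
      rw [hX, ← List.map_tail, List.tail_reverse]
    rw [hY] at h2
    rw [hY2] at h3
    obtain ⟨u, hu⟩ := exists_isLocus hXi
    have hpre : ∀ p, IsNode S p → p <+: u → p ≠ u → p <+: X.dropLast := by
      intro p hp hpu hne
      have hlt := hu.lt p hp hpu hne
      refine List.prefix_of_prefix_length_le hpu ((List.dropLast_prefix X).trans hu.isPrefix) ?_
      rw [List.length_dropLast]; omega
    have hu0 : u ≠ [] := by
      rintro rfl
      exact hX0 (List.prefix_nil.1 hu.isPrefix)
    obtain ⟨v, hv⟩ := exists_parent (S := S) hu0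
    have hvp := parent_eq_some.1 hv
    have hYne : X.dropLast ≠ u := by
      intro h
      have := hu.isPrefix.length_le
      rw [← h, List.length_dropLast] at this
      omega
    have hYu : X.dropLast <+: u := (List.dropLast_prefix X).trans hu.isPrefix
    have hYn : IsNode S X.dropLast := by
      by_contra hn
      have hloc : IsLocus S X.dropLast u := by
        refine ⟨hu.isNode, hYu, fun p hp hpu hne => ?_⟩
        have h4 := hpre p hp hpu hne
        refine lt_of_le_of_ne h4.length_le fun hl => hn ?_
        rw [← h4.eq_of_length hl]; exact hp
      exact h2 (hloc.nodeUnique_iff.1 (hu.nodeUnique_iff.2 h1))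
    have hvY : v = X.dropLast :=
      (hpre v hvp.1.1 hvp.1.2.1 hvp.1.2.2).eq_of_length_le
        (hvp.2 _ hYn hYu hYne).length_le
    have htake : u.take (v.length + 1) = X := by
      rw [hvY, List.length_dropLast, Nat.sub_add_cancel hXl]
      exact (List.prefix_iff_eq_take.1 hu.isPrefix).symm
    refine ⟨u, v, hu.isNode, hv, ⟨hu.nodeUnique_iff.2 h1, fun p hp hpu hne hpn => ?_⟩,
      (leftMin_eq_some hu.isNode).2 ⟨v, hv, hT, htake⟩, fun hc => ?_⟩
    · exact h2 (hpn.of_prefix (hpre p hp hpu hne))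
    · unfold slinkNode at hc
      rw [htake] at hc
      have hl := isLocus_locusNode ho ((List.tail_suffix X).isInfix.trans hXi)
      exact h3 (hl.nodeUnique_iff.1 hc.1)
  · rintro ⟨u, v, hu, hv, hLM, hT, hs⟩
    obtain ⟨v', hv', hT0, hX⟩ := (leftMin_eq_some hu).1 hT
    obtain rfl : v = v' := Option.some.inj (hv.symm.trans hv')
    obtain ⟨⟨hvn, hvu, hvne⟩, hmax⟩ := parent_eq_some.1 hv
    unfold slinkNode at hs
    have hXu : T.reverse.map some <+: u := hX ▸ List.take_prefix _ _
    have hXi := hXu.isInfix.trans hu.infix_text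
    have hTi : T <:+: S.str := by simpa using infix_of_infix_text hXi
    have hlt : v.length < u.length :=
      lt_of_le_of_ne hvu.length_le fun hl => hvne (hvu.eq_of_length hl)
    have hXl := congrArg List.length hX
    rw [List.length_take, min_eq_left (by omega)] at hXl
    rw [hX] at hs
    set X : Node α := T.reverse.map some with hXdef
    have hvX : v = X.dropLast := by
      have h1 : X.dropLast <+: u := (List.dropLast_prefix X).trans hXu
      exact (List.prefix_of_prefix_length_le hvu h1 (by simp [← hXl])).eq_of_length
        (by simp [← hXl])
    have hloc : IsLocus S X u := by
      refine ⟨hu, hXu, fun p hp hpu hne => ?_⟩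
      have := (hmax p hp hpu hne).length_le
      omega
    have hY : T.tail.reverse.map some = v := by
      rw [hvX, hXdef, ← List.map_dropLast, List.dropLast_reverse]
    have hY2 : T.dropLast.reverse.map some = X.tail := by
      rw [hXdef, ← List.map_tail, List.tail_reverse]
    have hvnu := hLM.2 v hvn hvu hvne
    refine ⟨hT0, ?_, (isMinUnique_iff hT0).2 ⟨?_, ?_, ?_⟩⟩
    -- With a delay beyond `n` every string is unique, including the parent `v`.
    · by_contra hd
      exact hvnu (nodeUnique_of_len_lt (by omega) v)
    · rw [isUnique_iff hTi]
      exact hloc.nodeUnique_iff.1 hLM.1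
    · rw [isUnique_iff ((List.tail_suffix T).isInfix.trans hTi), hY]
      exact hvnu
    · rw [isUnique_iff ((List.dropLast_prefix T).isInfix.trans hTi), hY2]
      intro hc
      have hl := isLocus_locusNode ho ((List.tail_suffix X).isInfix.trans hXi)
      -- If the suffix link target is unique, it is automatically left-minimal: for a unique proper
      -- ancestor `p`, prepending the first letter of `X` gives a prefix of `v` that is unique with
      -- delay `d`, so `v` would be unique.
      refine hs ⟨hl.nodeUnique_iff.2 hc, fun p hp hpu hne hpn => hvnu ?_⟩
      have h1 := hl.lt p hp hpu hne
      have h2 : p <+: X.tail := List.prefix_of_prefix_length_le hpu hl.isPrefix h1.le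
      obtain ⟨a, Z, hZ⟩ : ∃ (a : α) (Z : List α), T.reverse = a :: Z := by
        cases h : T.reverse with
        | nil => exact absurd (List.reverse_eq_nil_iff.1 h) hT0
        | cons a Z => exact ⟨a, Z, rfl⟩
      have hXc : X = some a :: X.tail := by rw [hXdef, hZ]; rfl
      have h3 : some a :: p <+: v := by
        refine List.prefix_of_prefix_length_le (l₃ := X) ?_ (hvX ▸ List.dropLast_prefix X) ?_
        · rw [hXc]; simpa using h2
        · rw [List.length_tail] at h1
          simp only [List.length_cons]; omega
      exact (hpn.cons a).of_prefix h3

end Unique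

/-! ### Correctness of the tournament tree and of the bitvector tables. -/

section Queue

variable {α : Type u} {γ : Type v}

/-- The leaf of index `i` lies below the entry `x` of the tournament tree with `2 ^ L` leaves. -/
def Below (L x i : ℕ) : Prop := i < 2 ^ L ∧ ∃ t, (2 ^ L + i) / 2 ^ t = x

theorem below_iff {L x i : ℕ} (hx : x < 2 ^ L) :
    Below L x i ↔ Below L (2 * x) i ∨ Below L (2 * x + 1) i := by
  constructor
  · rintro ⟨hi, t, ht⟩
    cases t with
    | zero => simp at ht; omega
    | succ t =>
      rw [pow_succ, ← Nat.div_div_eq_div_mul] at ht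
      rcases Nat.mod_two_eq_zero_or_one ((2 ^ L + i) / 2 ^ t) with h | h
      · exact Or.inl ⟨hi, t, by omega⟩
      · exact Or.inr ⟨hi, t, by omega⟩
  · rintro (⟨hi, t, ht⟩ | ⟨hi, t, ht⟩) <;>
    exact ⟨hi, t + 1, by rw [pow_succ, ← Nat.div_div_eq_div_mul, ht]; omega⟩

theorem below_one {L i : ℕ} (hi : i < 2 ^ L) : Below L 1 i :=
  ⟨hi, L, by rw [Nat.add_div_left _ (by positivity), Nat.div_eq_of_lt hi]⟩

theorem eq_of_below {L i j : ℕ} (h : Below L (2 ^ L + i) j) : j = i := by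
  obtain ⟨hj, t, ht⟩ := h
  cases t with
  | zero => simp at ht; exact ht
  | succ t =>
    have : (2 ^ L + j) / 2 ^ (t + 1) ≤ (2 ^ L + j) / 2 :=
      Nat.div_le_div_left (by rw [pow_succ]; have := Nat.one_le_two_pow (n := t); omega) (by omega)
    omega

/-- `o` is the winner among the inserted indices satisfying `A`. -/
def IsBest (key : ℕ → ℤ) (I A : ℕ → Prop) (o : Option ℕ) : Prop :=
  (o = none → ∀ i, A i → ¬ I i) ∧
    ∀ j, o = some j → A j ∧ I j ∧ ∀ i, A i → I i → key i < key j ∨ (key i = key j ∧ i ≤ j)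

theorem IsBest.better {key : ℕ → ℤ} {I A B C : ℕ → Prop} {o p : Option ℕ} (h : IsBest key I A o)
    (h' : IsBest key I B p) (hC : ∀ i, C i ↔ A i ∨ B i) :
    IsBest key I C (better key o p) := by
  unfold IsBest at *
  simp only [hC]
  cases o with
  | none =>
    have h1 := h.1 rfl
    cases p with
    | none =>
      have h2 := h'.1 rfl
      simp only [ColoredStrings.better]
      grind
    | some j =>
      have h2 := h'.2 j rfl
      simp only [ColoredStrings.better]
      grind
  | some i =>
    have h1 := h.2 i rfl
    cases p with
    | none =>
      have h2 := h'.1 rfl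
      simp only [ColoredStrings.better]
      grind
    | some j =>
      have h2 := h'.2 j rfl
      simp only [ColoredStrings.better]
      split_ifs <;> grind

/-- The tournament tree is correct for the inserted indices `I`. -/
def IsHeap (L : ℕ) (I : ℕ → Prop) (key : ℕ → ℤ) (win : ℕ → Option ℕ) : Prop :=
  ∀ z, 1 ≤ z → z < 2 ^ (L + 1) → IsBest key I (Below L z) (win z)

theorem climb_frame (l x : ℕ) (s : Store α) :
    (s.climb l x).key = s.key ∧ (s.climb l x).rank = s.rank ∧
      (s.climb l x).select = s.select ∧ (s.climb l x).leftMinimal = s.leftMinimal ∧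
      (s.climb l x).out = s.out ∧ (s.climb l x).demotes = s.demotes ∧
      (s.climb l x).idle = s.idle ∧ (s.climb l x).time = s.time + l := by
  induction l generalizing x s with
  | zero => simp [Store.climb]
  | succ l ih =>
    unfold Store.climb
    obtain ⟨h1, h2, h3, h4, h5, h6, h7, h8⟩ := ih (x / 2)
      { s.tick with
        win := Function.update s.win x (better s.key (s.win (2 * x)) (s.win (2 * x + 1))) }
    exact ⟨h1, h2, h3, h4, h5, h6, h7, h8.trans (by simp only [Store.tick]; omega)⟩

/-- Only entries on the path `x / 2 ^ t` may be wrong. Each step repairs the lowest of them from two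
entries off the path, and since `x < 2 ^ l` the path is used up after `l` steps. -/
theorem isHeap_climb {L : ℕ} {I : ℕ → Prop} (l x : ℕ) (s : Store α) (hl : l ≤ L) (hx : x < 2 ^ l)
    (h : ∀ z, 1 ≤ z → z < 2 ^ (L + 1) → (∀ t, z ≠ x / 2 ^ t) →
      IsBest s.key I (Below L z) (s.win z)) :
    IsHeap L I s.key (s.climb l x).win := by
  induction l generalizing x s with
  | zero =>
    intro z h1 h2
    have : x = 0 := by simpa using hx
    subst this
    exact h z h1 h2 fun t => by simp; omega
  | succ l ih =>
    unfold Store.climb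
    have h2l : 2 ^ (l + 1) ≤ 2 ^ L := Nat.pow_le_pow_right (by omega) hl
    refine ih (x / 2)
      { s.tick with
        win := Function.update s.win x (better s.key (s.win (2 * x)) (s.win (2 * x + 1))) }
      (by omega) (by rw [pow_succ] at hx; omega) fun z h1 h2 h3 => ?_
    by_cases hz : z = x
    · subst hz
      simp only [Store.tick, Function.update_self]
      have hle : ∀ t, z / 2 ^ t ≤ z := fun t => Nat.div_le_self _ _
      have hpow := pow_succ 2 L
      refine IsBest.better (h (2 * z) (by omega) (by omega) fun t => ?_)
        (h (2 * z + 1) (by omega) (by omega) fun t => ?_) fun i => below_iff (by omega)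
      · have := hle t; omega
      · have := hle t; omega
    · simp only [Store.tick, Function.update_of_ne hz]
      refine h z h1 h2 fun t => ?_
      cases t with
      | zero => simpa using hz
      | succ t =>
        rw [pow_succ, mul_comm, ← Nat.div_div_eq_div_mul]
        exact h3 t

theorem setKey_frame (L i : ℕ) (k : ℤ) (s : Store α) :
    (s.setKey L i k).key = Function.update s.key i k ∧ (s.setKey L i k).rank = s.rank ∧
      (s.setKey L i k).select = s.select ∧ (s.setKey L i k).leftMinimal = s.leftMinimal ∧
      (s.setKey L i k).out = s.out ∧ (s.setKey L i k).demotes = s.demotes ∧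
      (s.setKey L i k).idle = s.idle ∧ (s.setKey L i k).time = s.time + 1 + L := by
  unfold Store.setKey
  exact climb_frame _ _ _

/-- A changed key affects only the entries above its leaf. Allowing `I'` to gain `i` makes one
statement serve both `insert` and `demote`. -/
theorem isHeap_setKey {L i : ℕ} {k : ℤ} {I I' : ℕ → Prop} {s : Store α} (hi : i < 2 ^ L)
    (h : IsHeap L I s.key s.win) (hI : ∀ j, I' j ↔ I j ∨ j = i) :
    IsHeap L I' (s.setKey L i k).key (s.setKey L i k).win := by
  rw [(setKey_frame L i k s).1]
  unfold Store.setKey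
  have hpow := pow_succ 2 L
  refine isHeap_climb L ((2 ^ L + i) / 2) { s.tick with
      key := Function.update s.key i k
      win := Function.update s.win (2 ^ L + i) (some i) } le_rfl (by omega) fun z h1 h2 h3 => ?_
  simp only
  by_cases hz : z = 2 ^ L + i
  · subst hz
    rw [Function.update_self]
    refine ⟨by simp, ?_⟩
    rintro j hj
    obtain rfl : i = j := Option.some.inj hj
    refine ⟨⟨hi, 0, by simp⟩, (hI _).2 (Or.inr rfl), fun a ha _ => ?_⟩
    rw [eq_of_below ha]
    exact Or.inr ⟨rfl, le_rfl⟩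
  · rw [Function.update_of_ne hz]
    have hnb : ¬ Below L z i := by
      rintro ⟨-, t, ht⟩
      cases t with
      | zero => exact hz (by simpa using ht.symm)
      | succ t =>
        rw [pow_succ, mul_comm, ← Nat.div_div_eq_div_mul] at ht
        exact h3 t ht.symm
    have hne : ∀ j, Below L z j → j ≠ i := fun j hj hji => hnb (hji ▸ hj)
    obtain ⟨h4, h5⟩ := h z h1 h2
    refine ⟨fun hn j hj hIj => ?_, fun j hj => ?_⟩
    · rcases (hI j).1 hIj with h6 | h6
      · exact h4 hn j hj h6
      · exact hne j hj h6
    · obtain ⟨h6, h7, h8⟩ := h5 j hj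
      refine ⟨h6, (hI j).2 (Or.inl h7), fun a ha hIa => ?_⟩
      rw [Function.update_of_ne (hne a ha), Function.update_of_ne (hne j h6)]
      rcases (hI a).1 hIa with h9 | h9
      · exact h8 a ha h9
      · exact absurd h9 (hne a ha)

theorem IsHeap.max_spec {L : ℕ} {I : ℕ → Prop} {s : Store α} (h : IsHeap L I s.key s.win)
    (hI : ∀ i, I i → i < 2 ^ L) (hne : ∃ i, I i) :
    ∃ i, I i ∧ s.max = some (i, s.key i) ∧
      ∀ j, I j → s.key j < s.key i ∨ (s.key j = s.key i ∧ j ≤ i) := by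
  obtain ⟨h1, h2⟩ := h 1 le_rfl (Nat.one_lt_two_pow (by omega))
  cases hw : s.win 1 with
  | none =>
    obtain ⟨i, hi⟩ := hne
    exact absurd hi (h1 hw i (below_one (hI i hi)))
  | some i =>
    obtain ⟨-, h4, h5⟩ := h2 i hw
    exact ⟨i, h4, by simp [Store.max, hw], fun j hj => h5 j (below_one (hI j hj)) hj⟩

/-! The tables for rank and select. -/

variable [DecidableEq γ]

/-- `select (rank q)` is the position of the last one of the bitvector before `q`. -/
def IsPred (S : ColoredString α γ) (y : γ) (q : ℕ) (x : ℤ) : Prop :=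
  (x = -1 ∨ ∃ p < q, x = p ∧ bit S y p = true) ∧ ∀ p < q, bit S y p = true → (p : ℤ) ≤ x

theorem bit_zero (S : ColoredString α γ) (y : γ) : bit S y 0 = false := by
  simp [bit, ColoredString.colorAt]

/-- The first `m` positions of the bitvector have been preprocessed. -/
structure IsScanned (S : ColoredString α γ) (y : γ) (m : ℕ) (s : Store α) : Prop where
  pred : ∀ q ≤ m + 1, IsPred S y q (s.select (s.rank q))
  rank_le : ∀ q ≤ m + 1, s.rank q ≤ s.ones
  rank_last : s.rank (m + 1) = s.ones

/-- A new `select` entry has index `ones + 1`, larger than every rank stored so far, so earlier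
predecessor values are unaffected. `rank` counts strictly earlier positions, hence the tables reach
one position past those scanned. -/
theorem isScanned_scan {S : ColoredString α γ} {y : γ} {m : ℕ} {s : Store α}
    (h : IsScanned S y m s) : IsScanned S y (m + 1) (Store.scan S y s (m + 1)) := by
  have hlast := h.pred (m + 1) le_rfl
  rw [h.rank_last] at hlast
  have hne : ∀ q ≤ m + 1, q ≠ m + 1 + 1 := by omega
  have hne2 : ∀ q ≤ m + 1, s.rank q ≠ s.ones + 1 := fun q hq => by have := h.rank_le q hq; omega
  unfold Store.scan
  split_ifs with hb
  · refine ⟨fun q hq => ?_, fun q hq => ?_, by simp⟩ <;> rcases Nat.lt_or_ge q (m + 2) with hq' | hq'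
    · simp only [Function.update_of_ne (hne q (by omega)), Function.update_of_ne (hne2 q (by omega))]
      exact h.pred q (by omega)
    · obtain rfl : q = m + 1 + 1 := by omega
      simp only [Function.update_self]
      exact ⟨Or.inr ⟨m + 1, by omega, rfl, hb⟩, fun p hp _ => by omega⟩
    · simp only [Function.update_of_ne (hne q (by omega))]
      have := h.rank_le q (by omega)
      omega
    · obtain rfl : q = m + 1 + 1 := by omega
      simp
  · refine ⟨fun q hq => ?_, fun q hq => ?_, by simp [Store.tick]⟩ <;>
      rcases Nat.lt_or_ge q (m + 2) with hq' | hq'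
    · simp only [Function.update_of_ne (hne q (by omega)), Store.tick]
      exact h.pred q (by omega)
    · obtain rfl : q = m + 1 + 1 := by omega
      simp only [Function.update_self, Store.tick]
      refine ⟨?_, fun p hp hpb => ?_⟩
      · rcases hlast.1 with h1 | ⟨p, hp, h1⟩
        · exact Or.inl h1
        · exact Or.inr ⟨p, by omega, h1⟩
      · refine hlast.2 p (lt_of_le_of_ne (by omega) ?_) hpb
        rintro rfl
        exact hb hpb
    · simp only [Function.update_of_ne (hne q (by omega)), Store.tick]
      exact h.rank_le q (by omega)
    · obtain rfl : q = m + 1 + 1 := by omega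
      simp [Store.tick]

/-- The part of the store that `preprocess` leaves unchanged. -/
theorem scan_frame (S : ColoredString α γ) (y : γ) (s : Store α) (p : ℕ) :
    (Store.scan S y s p).win = s.win ∧ (Store.scan S y s p).leftMinimal = s.leftMinimal ∧
      (Store.scan S y s p).out = s.out ∧ (Store.scan S y s p).demotes = s.demotes ∧
      (Store.scan S y s p).idle = s.idle ∧ (Store.scan S y s p).time = s.time + 1 := by
  unfold Store.scan
  split_ifs <;> simp [Store.tick]

theorem preprocess_spec (S : ColoredString α γ) (y : γ) :
    let s : Store α := Store.preprocess S y Store.empty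
    IsScanned S y (2 * S.len) s ∧ (∀ i, s.win i = none) ∧ (∀ p i, s.leftMinimal p i = none) ∧
      s.out = [] ∧ (∀ i, s.demotes i = 0) ∧ s.idle = 0 ∧ s.time = 2 * S.len := by
  unfold Store.preprocess
  generalize 2 * S.len = m
  induction m with
  | zero =>
    refine ⟨⟨fun q hq => ?_, fun q _ => le_rfl, rfl⟩, fun _ => rfl, fun _ _ => rfl, rfl,
      fun _ => rfl, rfl, rfl⟩
    refine ⟨Or.inl rfl, fun p hp hb => ?_⟩
    obtain rfl : p = 0 := by omega
    simp [bit_zero] at hb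
  | succ m ih =>
    simp only [List.range_succ, List.foldl_append, List.foldl_cons, List.foldl_nil] at ih ⊢
    obtain ⟨h1, h2, h3, h4, h5, h6, h7⟩ := ih
    obtain ⟨g1, g2, g3, g4, g5, g6⟩ := scan_frame S y
      ((List.range m).foldl (fun s q => Store.scan S y s (q + 1)) (Store.empty : Store α)) (m + 1)
    rw [g1, g2, g3, g4, g5, g6]
    exact ⟨isScanned_scan h1, h2, h3, h4, h5, h6, by rw [h7]⟩

end Queue

/-! ### Cost accounting and the effect of the two demoting procedures. -/

section Procedures

variable {α : Type u} {γ : Type v} [DecidableEq α] [DecidableEq γ]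

/-- The total number of demotions. -/
def totalDemotes (ord : List (Node α)) (s : Store α) : ℕ :=
  ∑ i ∈ Finset.range ord.length, s.demotes i

/-- Queue operations lead from `s` to `s'`, and the demotions pay for the steps other than idle
visits, with `a` steps left. -/
structure Evolves (ord : List (Node α)) (a : ℤ) (s s' : Store α) : Prop where
  rank : s'.rank = s.rank
  select : s'.select = s.select
  leftMinimal : s'.leftMinimal = s.leftMinimal
  out : s'.out = s.out
  heap : IsHeap (levels ord) (· < ord.length) s.key s.win →
    IsHeap (levels ord) (· < ord.length) s'.key s'.win
  cost : (s'.time : ℤ) + a + ((levels ord : ℤ) + 8) * totalDemotes ord s + s.idle ≤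
    s.time + ((levels ord : ℤ) + 8) * totalDemotes ord s' + s'.idle

variable {ord : List (Node α)}

theorem Evolves.trans {a b : ℤ} {s s' s'' : Store α} (h : Evolves ord a s s')
    (h' : Evolves ord b s' s'') : Evolves ord (a + b) s s'' where
  rank := h'.rank.trans h.rank
  select := h'.select.trans h.select
  leftMinimal := h'.leftMinimal.trans h.leftMinimal
  out := h'.out.trans h.out
  heap := h'.heap ∘ h.heap
  cost := by have := h.cost; have := h'.cost; linarith

theorem Evolves.mono {a b : ℤ} {s s' : Store α} (h : Evolves ord a s s') (hba : b ≤ a) :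
    Evolves ord b s s' :=
  ⟨h.rank, h.select, h.leftMinimal, h.out, h.heap, by have := h.cost; linarith⟩

theorem Evolves.refl (s : Store α) : Evolves ord 0 s s :=
  ⟨rfl, rfl, rfl, rfl, id, by linarith⟩

theorem evolves_tick (s : Store α) : Evolves ord (-1) s s.tick :=
  ⟨rfl, rfl, rfl, rfl, id, by simp [Store.tick, totalDemotes]⟩

theorem length_le_two_pow_levels (ord : List (Node α)) : ord.length ≤ 2 ^ levels ord :=
  Nat.le_pow_clog (by norm_num) _

theorem totalDemotes_demote {i : ℕ} (hi : i < ord.length) (L : ℕ) (k : ℤ) (s : Store α) :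
    totalDemotes ord (s.demote L i k) = totalDemotes ord s + 1 := by
  unfold totalDemotes Store.demote
  simp only
  have hm := Finset.mem_range.2 hi
  rw [← Finset.add_sum_erase _ _ hm, ← Finset.add_sum_erase _ s.demotes hm, Function.update_self]
  have : ∑ x ∈ (Finset.range ord.length).erase i, Function.update s.demotes i (s.demotes i + 1) x =
      ∑ x ∈ (Finset.range ord.length).erase i, s.demotes x :=
    Finset.sum_congr rfl fun x hx => Function.update_of_ne (Finset.ne_of_mem_erase hx) _ _
  omega

/-- A demotion earns `levels ord + 8` and takes `levels ord + 1` steps, which leaves `7`. -/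
theorem evolves_demote {i : ℕ} (hi : i < ord.length) (k : ℤ) (s : Store α) :
    Evolves ord 7 s (s.demote (levels ord) i k) := by
  obtain ⟨-, h2, h3, h4, h5, -, h7, h8⟩ := setKey_frame (levels ord) i k s
  refine ⟨h2, h3, h4, h5, fun h => ?_, ?_⟩
  · exact isHeap_setKey (lt_of_lt_of_le hi (length_le_two_pow_levels ord)) h fun j => by
      constructor
      · exact Or.inl
      · rintro (h | rfl)
        · exact h
        · exact hi
  · rw [totalDemotes_demote hi]
    have h9 : (s.demote (levels ord) i k).time = s.time + 1 + levels ord := h8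
    have h10 : (s.demote (levels ord) i k).idle = s.idle := h7
    rw [h9, h10]
    push_cast
    linarith

/-- The key of a node. -/
def nodeKey (ord : List (Node α)) (s : Store α) (u : Node α) : ℤ := s.key (iBFS ord u)

/-- The number of demotions of a node. -/
def nodeDemotes (ord : List (Node α)) (s : Store α) (u : Node α) : ℕ := s.demotes (iBFS ord u)

theorem nodeKey_demote_self (u : Node α) (k : ℤ) (s : Store α) :
    nodeKey ord (s.demote (levels ord) (iBFS ord u) k) u = k ∧
      nodeDemotes ord (s.demote (levels ord) (iBFS ord u) k) u = nodeDemotes ord s u + 1 := by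
  refine ⟨?_, by simp [nodeDemotes, Store.demote]⟩
  unfold nodeKey
  change (s.setKey _ _ _).key _ = _
  rw [(setKey_frame _ _ _ _).1, Function.update_self]

theorem nodeKey_demote_of_ne {u w : Node α} (hu : u ∈ ord) (hw : w ∈ ord) (h : w ≠ u) (k : ℤ)
    (s : Store α) :
    nodeKey ord (s.demote (levels ord) (iBFS ord u) k) w = nodeKey ord s w ∧
      nodeDemotes ord (s.demote (levels ord) (iBFS ord u) k) w = nodeDemotes ord s w := by
  have hne : iBFS ord w ≠ iBFS ord u := fun h' => h (iBFS_inj hw hu h')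
  refine ⟨?_, by simp [nodeDemotes, Store.demote, Function.update_of_ne hne]⟩
  unfold nodeKey
  change (s.setKey _ _ _).key _ = _
  rw [(setKey_frame _ _ _ _).1, Function.update_of_ne hne]

/-- The nodes below `u` have been demoted by the recursive procedure started with `ℓ`. -/
structure Updated (S : ColoredString α γ) (y : γ) (ord : List (Node α)) (ℓ : ℕ) (u : Node α)
    (s s' : Store α) : Prop where
  demotes : ∀ w, IsNode S w → u <+: w → nodeDemotes ord s' w = nodeDemotes ord s w + 1
  neg_one_le : ∀ w, IsNode S w → u <+: w → -1 ≤ nodeKey ord s' w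
  lt : ∀ w, IsNode S w → u <+: w → nodeKey ord s' w < ℓ
  mono : ∀ v w, IsNode S v → IsNode S w → u <+: v → v <+: w → nodeKey ord s' v ≤ nodeKey ord s' w
  le_of_unique : ∀ w, IsNode S w → u <+: w → ∀ d < ℓ, NodeUnique S y d w → d ≤ nodeKey ord s' w
  leaf : ∀ w, IsLeaf S w → u <+: w → nodeKey ord s' w = -1 ∨
    ∃ p : ℕ, nodeKey ord s' w = p ∧ bit S y (w.length - 1 + p) = true

variable {S : ColoredString α γ} {y : γ}

theorem Updated.congr {ℓ : ℕ} {u : Node α} {s s' t t' : Store α} (h : Updated S y ord ℓ u s s')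
    (h1 : ∀ w, IsNode S w → u <+: w → nodeDemotes ord t w = nodeDemotes ord s w)
    (h2 : ∀ w, IsNode S w → u <+: w → nodeDemotes ord t' w = nodeDemotes ord s' w)
    (h3 : ∀ w, IsNode S w → u <+: w → nodeKey ord t' w = nodeKey ord s' w) :
    Updated S y ord ℓ u t t' where
  demotes w hw hu := by rw [h1 w hw hu, h2 w hw hu, h.demotes w hw hu]
  neg_one_le w hw hu := by rw [h3 w hw hu]; exact h.neg_one_le w hw hu
  lt w hw hu := by rw [h3 w hw hu]; exact h.lt w hw hu
  mono v w hv hw huv hvw := by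
    rw [h3 v hv huv, h3 w hw (huv.trans hvw)]; exact h.mono v w hv hw huv hvw
  le_of_unique w hw hu := by rw [h3 w hw hu]; exact h.le_of_unique w hw hu
  leaf w hw hu := by rw [h3 w hw.isNode hu]; exact h.leaf w hw hu

/-- The tables of the store are correct. -/
def HasTables (S : ColoredString α γ) (y : γ) (s : Store α) : Prop :=
  ∀ q ≤ 2 * S.len + 1, IsPred S y q (s.select (s.rank q))

theorem HasTables.congr {s s' : Store α} (h : HasTables S y s) (h1 : s'.rank = s.rank)
    (h2 : s'.select = s.select) : HasTables S y s' := by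
  unfold HasTables; rw [h1, h2]; exact h

/-- The effect of the recursive procedure. -/
structure HSpec (S : ColoredString α γ) (y : γ) (ord : List (Node α)) (ℓ : ℕ) (u : Node α)
    (s : Store α) (r : ℤ × Store α) : Prop where
  evolves : Evolves ord 5 s r.2
  idle : r.2.idle = s.idle
  off : ∀ w, IsNode S w → ¬ u <+: w → nodeKey ord r.2 w = nodeKey ord s w ∧
    nodeDemotes ord r.2 w = nodeDemotes ord s w
  updated : Updated S y ord ℓ u s r.2
  val : r.1 = nodeKey ord r.2 u

/-- The effect of the recursive procedure on the subtrees of the nodes in `cs`. -/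
structure FoldSpec (S : ColoredString α γ) (y : γ) (ord : List (Node α)) (ℓ : ℕ)
    (cs : List (Node α)) (a : ℤ × Store α) (r : ℤ × Store α) : Prop where
  evolves : Evolves ord 0 a.2 r.2
  idle : r.2.idle = a.2.idle
  off : ∀ w, IsNode S w → (∀ c ∈ cs, ¬ c <+: w) → nodeKey ord r.2 w = nodeKey ord a.2 w ∧
    nodeDemotes ord r.2 w = nodeDemotes ord a.2 w
  updated : ∀ c ∈ cs, Updated S y ord ℓ c a.2 r.2
  le : r.1 ≤ a.1
  le_of_mem : ∀ c ∈ cs, r.1 ≤ nodeKey ord r.2 c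
  val : r.1 = a.1 ∨ ∃ c ∈ cs, r.1 = nodeKey ord r.2 c

/-- Subtrees of different children are disjoint, so each call leaves the effects of the others
intact. The surplus of a call pays for the tick before it. -/
theorem foldSpec_foldl {ℓ : ℕ} (F : Node α → Store α → ℤ × Store α) (cs : List (Node α))
    (hF : ∀ c ∈ cs, ∀ s, HasTables S y s → HSpec S y ord ℓ c s (F c s))
    (hn : ∀ c ∈ cs, IsNode S c)
    (hd : cs.Pairwise fun c c' => ∀ w, c <+: w → ¬ c' <+: w)
    (a : ℤ × Store α) (ha : HasTables S y a.2) :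
    FoldSpec S y ord ℓ cs a (cs.foldl (fun (a : ℤ × Store α) v =>
      let b := F v a.2.tick
      (if b.1 < a.1 then b.1 else a.1, b.2)) a) := by
  induction cs generalizing a with
  | nil =>
    exact ⟨Evolves.refl _, rfl, fun _ _ _ => ⟨rfl, rfl⟩, by simp, le_rfl, by simp, Or.inl rfl⟩
  | cons c cs ih =>
    rw [List.foldl_cons]
    rw [List.pairwise_cons] at hd
    have hc := hF c (by simp) a.2.tick (ha.congr rfl rfl)
    generalize hb : F c a.2.tick = b at hc ⊢
    simp only
    set a' : ℤ × Store α := (if b.1 < a.1 then b.1 else a.1, b.2) with ha'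
    have hle1 : a'.1 ≤ b.1 := by simp only [ha']; split_ifs <;> omega
    have hle2 : a'.1 ≤ a.1 := by simp only [ha']; split_ifs <;> omega
    have hor : a'.1 = a.1 ∨ a'.1 = b.1 := by simp only [ha']; split_ifs <;> simp
    have hev := (evolves_tick (ord := ord) a.2).trans hc.evolves
    have h := ih (fun c' hc' => hF c' (List.mem_cons_of_mem _ hc'))
      (fun c' hc' => hn c' (List.mem_cons_of_mem _ hc')) hd.2 a'
      (ha.congr hev.rank hev.select)
    generalize List.foldl _ a' cs = r at h ⊢
    have hoffc : ∀ w, IsNode S w → c <+: w → nodeKey ord r.2 w = nodeKey ord b.2 w ∧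
        nodeDemotes ord r.2 w = nodeDemotes ord b.2 w :=
      fun w hw hcw => h.off w hw fun c' hc' => hd.1 c' hc' w hcw
    refine ⟨(hev.trans h.evolves).mono (by norm_num), h.idle.trans hc.idle, fun w hw hcw => ?_,
      fun c' hc' => ?_, h.le.trans hle2, fun c' hc' => ?_, ?_⟩
    · have h1 := h.off w hw fun c' hc' => hcw c' (List.mem_cons_of_mem _ hc')
      have h2 := hc.off w hw (hcw c (by simp))
      exact ⟨h1.1.trans h2.1, h1.2.trans h2.2⟩
    · rcases List.mem_cons.1 hc' with rfl | hc'
      · exact hc.updated.congr (fun _ _ _ => rfl) (fun w hw hcw => (hoffc w hw hcw).2)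
          (fun w hw hcw => (hoffc w hw hcw).1)
      · refine (h.updated c' hc').congr (fun w hw hcw => ?_) (fun _ _ _ => rfl) (fun _ _ _ => rfl)
        exact ((hc.off w hw fun hcw' => hd.1 c' hc' w hcw' hcw).2).symm
    · rcases List.mem_cons.1 hc' with rfl | hc'
      · rw [(hoffc c' (hn c' (by simp)) List.prefix_rfl).1, ← hc.val]
        exact h.le.trans hle1
      · exact h.le_of_mem c' hc'
    · rcases h.val with h1 | ⟨c', hc', h1⟩
      · rcases hor with h2 | h2
        · exact Or.inl (h1.trans h2)
        · refine Or.inr ⟨c, by simp, ?_⟩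
          rw [(hoffc c (hn c (by simp)) List.prefix_rfl).1, ← hc.val]
          exact h1.trans h2
      · exact Or.inr ⟨c', List.mem_cons_of_mem _ hc', h1⟩

/-- The new key is the last set bit before `j + ℓ`, shifted by `j`; thus no smaller delay with a set
bit is passed over. Since `j ≤ n` and `ℓ ≤ n + 1`, the query stays within the tables. -/
theorem hSpec_leaf (ho : IsLevelOrder S ord) {ℓ : ℕ} (hℓ : ℓ ≤ S.len + 1) {u : Node α}
    (hu : IsLeaf S u) {s : Store α} (hs : HasTables S y s) {j : ℕ} (hj : j = u.length - 1) {m : ℤ}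
    (hm : m = max (s.select (s.rank (j + ℓ)) - (j : ℤ)) (-1)) :
    HSpec S y ord ℓ u s (m, s.tick.demote (levels ord) (iBFS ord u) m) := by
  have hmem := (ho.mem_iff u).2 hu.isNode
  have hev := (evolves_tick (ord := ord) s).trans (evolves_demote (iBFS_lt hmem) m s.tick)
  have hul := hu.length_le
  have hsub : ∀ w, IsNode S w → u <+: w → w = u := fun w hw h => hu.eq_of_prefix hw.infix_text h
  obtain ⟨hself1, hself2⟩ := nodeKey_demote_self (ord := ord) u m s.tick
  obtain ⟨hp1, hp2⟩ := hs (j + ℓ) (by omega)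
  generalize s.select (s.rank (j + ℓ)) = x at *
  refine ⟨hev.mono (by norm_num), (setKey_frame _ _ _ _).2.2.2.2.2.2.1, fun w hw h => ?_, ?_,
    hself1.symm⟩
  · refine nodeKey_demote_of_ne hmem ((ho.mem_iff w).2 hw) ?_ m s.tick
    rintro rfl
    exact h List.prefix_rfl
  · refine ⟨fun w hw h => ?_, fun w hw h => ?_, fun w hw h => ?_, fun v w hv hw h h' => ?_,
      fun w hw h d hd hun => ?_, fun w hw h => ?_⟩
    · rw [hsub w hw h]; exact hself2
    · rw [hsub w hw h, hself1]; omega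
    · rw [hsub w hw h, hself1]
      rcases hp1 with rfl | ⟨p, hp, rfl, -⟩ <;> omega
    · rw [hsub w hw (h.trans h'), hsub v hv h]
    · rw [hsub w hw h] at hun ⊢
      rw [hself1]
      have h1 := hun u hu List.prefix_rfl
      rw [← hj] at h1
      have := hp2 (j + d) (by omega) h1
      push_cast at this
      omega
    · rw [hsub w hw.isNode h, hself1, ← hj]
      by_cases hm0 : m = -1
      · exact Or.inl hm0
      · refine Or.inr ⟨m.toNat, by omega, ?_⟩
        rcases hp1 with rfl | ⟨p, hp, rfl, hb⟩
        · omega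
        · rw [show j + m.toNat = p by omega]
          exact hb

/-- The depth bound never runs out: `fuel + u.length` stays at least `n + 2`, children are strictly
longer, and nodes have length at most `n + 1`. At an inner node the minimum over the children keeps
keys monotone, and it skips no delay at which `u` is unique because the children are then unique
too. -/
theorem hSpec_hProc (ho : IsLevelOrder S ord) {ℓ : ℕ} (hℓ : ℓ ≤ S.len + 1) (fuel : ℕ)
    {u : Node α} (hu : IsNode S u) (hf : S.len + 2 ≤ fuel + u.length) (s : Store α)
    (hs : HasTables S y s) : HSpec S y ord ℓ u s (hProc S ord fuel u ℓ s) := by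
  induction fuel generalizing u s with
  | zero => have := hu.length_le; omega
  | succ fuel ih =>
    unfold hProc
    have hmem := (ho.mem_iff u).2 hu
    split_ifs with hl
    · have hul := hl.length_le
      have hul' := hl.length_pos
      exact hSpec_leaf ho hℓ hl hs (by unfold leafNumber; omega) rfl
    · have hcl : ∀ c ∈ children S ord u, u.length < c.length := fun c hc => by
        obtain ⟨-, h1, h2⟩ := child_prefix ho hc
        exact lt_of_le_of_ne h1.length_le fun h => h2 (h1.eq_of_length h)
      have hfold := foldSpec_foldl (S := S) (y := y) (ord := ord) (ℓ := ℓ)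
        (fun v s => hProc S ord fuel v ℓ s) (children S ord u)
        (fun c hc s hs => ih (child_prefix ho hc).1 (by have := hcl c hc; omega) s hs)
        (fun c hc => (child_prefix ho hc).1)
        ((nodup_children ho u).imp_of_mem fun hc hc' hne w hw hw' =>
          hne (child_unique ho hc hc' hw hw'))
        ((ℓ : ℤ) - 1, s.tick) (hs.congr rfl rfl)
      generalize List.foldl _ ((ℓ : ℤ) - 1, s.tick) (children S ord u) = r at hfold ⊢
      obtain ⟨hself1, hself2⟩ := nodeKey_demote_self (ord := ord) u r.1 r.2
      have hne : ∀ w, IsNode S w → w ≠ u → _ := fun w hw h =>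
        nodeKey_demote_of_ne hmem ((ho.mem_iff w).2 hw) h r.1 r.2
      have hev := ((evolves_tick (ord := ord) s).trans hfold.evolves).trans
        (evolves_demote (iBFS_lt hmem) r.1 r.2)
      have hidle : (r.2.demote (levels ord) (iBFS ord u) r.1).idle = s.idle :=
        (setKey_frame _ _ _ _).2.2.2.2.2.2.1.trans hfold.idle
      simp only
      generalize r.2.demote (levels ord) (iBFS ord u) r.1 = s' at *
      have hnc : ∀ c ∈ children S ord u, ¬ c <+: u := fun c hc h => by
        have := hcl c hc; have := h.length_le; omega
      have hupd : ∀ c ∈ children S ord u, Updated S y ord ℓ c s s' := fun c hc => by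
        have h : ∀ w, c <+: w → w ≠ u := fun w hcw h => hnc c hc (h ▸ hcw)
        exact (hfold.updated c hc).congr (fun _ _ _ => rfl)
          (fun w hw hcw => (hne w hw (h w hcw)).2) (fun w hw hcw => (hne w hw (h w hcw)).1)
      have hval : nodeKey ord s' u = (ℓ : ℤ) - 1 ∨
          ∃ c ∈ children S ord u, nodeKey ord s' u = nodeKey ord s' c := by
        rw [hself1]
        rcases hfold.val with h | ⟨c, hc, h⟩
        · exact Or.inl h
        · refine Or.inr ⟨c, hc, ?_⟩
          rw [(hne c (child_prefix ho hc).1 (child_prefix ho hc).2.2.symm).1, h]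
      have hle : ∀ c ∈ children S ord u, nodeKey ord s' u ≤ nodeKey ord s' c := fun c hc => by
        rw [hself1, (hne c (child_prefix ho hc).1 (child_prefix ho hc).2.2.symm).1]
        exact hfold.le_of_mem c hc
      refine ⟨hev.mono (by norm_num), hidle, fun w hw h => ?_, ?_, hself1.symm⟩
      · have h1 := hne w hw (by rintro rfl; exact h List.prefix_rfl)
        have h2 := hfold.off w hw fun c hc hcw => h ((child_prefix ho hc).2.1.trans hcw)
        exact ⟨h1.1.trans h2.1, h1.2.trans h2.2⟩
      · have hcase : ∀ w, IsNode S w → u <+: w → w = u ∨ ∃ c ∈ children S ord u, c <+: w := by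
          intro w hw huw
          by_cases h : w = u
          · exact Or.inl h
          · exact Or.inr (exists_child ho hu hw huw (Ne.symm h))
        refine ⟨fun w hw h => ?_, fun w hw h => ?_, fun w hw h => ?_, fun v w hv hw h h' => ?_,
          fun w hw h d hd hun => ?_, fun w hw h => ?_⟩
        · rcases hcase w hw h with rfl | ⟨c, hc, hcw⟩
          · rw [hself2, (hfold.off w hw fun c hc => hnc c hc).2]; rfl
          · exact (hupd c hc).demotes w hw hcw
        · rcases hcase w hw h with rfl | ⟨c, hc, hcw⟩
          · change -1 ≤ nodeKey ord s' w
            rcases hval with h1 | ⟨c, hc, h1⟩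
            · omega
            · rw [h1]; exact (hupd c hc).neg_one_le c (child_prefix ho hc).1 List.prefix_rfl
          · exact (hupd c hc).neg_one_le w hw hcw
        · rcases hcase w hw h with rfl | ⟨c, hc, hcw⟩
          · have := hfold.le
            rw [hself1]; omega
          · exact (hupd c hc).lt w hw hcw
        · rcases hcase v hv h with rfl | ⟨c, hc, hcv⟩
          · rcases hcase w hw h' with rfl | ⟨c, hc, hcw⟩
            · exact le_rfl
            · exact (hle c hc).trans
                ((hupd c hc).mono c w (child_prefix ho hc).1 hw List.prefix_rfl hcw)
          · exact (hupd c hc).mono v w hv hw hcv h'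
        · rcases hcase w hw h with rfl | ⟨c, hc, hcw⟩
          · change (d : ℤ) ≤ nodeKey ord s' w
            rcases hval with h1 | ⟨c, hc, h1⟩
            · omega
            · rw [h1]
              exact (hupd c hc).le_of_unique c (child_prefix ho hc).1 List.prefix_rfl d hd
                (hun.of_prefix (child_prefix ho hc).2.1)
          · exact (hupd c hc).le_of_unique w hw hcw d hd hun
        · rcases hcase w hw.isNode h with rfl | ⟨c, hc, hcw⟩
          · exact absurd hw hl
          · exact (hupd c hc).leaf w hw hcw

/-- The effect of the loop over the ancestors. -/
structure AncestorSpec (S : ColoredString α γ) (ord : List (Node α)) (brk : Bool) (m : ℤ)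
    (vs : List (Node α)) (s s' : Store α) : Prop where
  evolves : Evolves ord 0 s s'
  off : ∀ w, IsNode S w → w ∉ vs → nodeKey ord s' w = nodeKey ord s w
  on : ∀ w ∈ vs, nodeKey ord s' w = min (nodeKey ord s w) m
  demotes : ∀ w, IsNode S w → nodeDemotes ord s' w + nodeKey ord s' w ≤
    nodeDemotes ord s w + nodeKey ord s w
  totalDemotes_le : totalDemotes ord s ≤ totalDemotes ord s'
  idle : brk = true → s'.idle ≤ s.idle + 1

/-- Keys do not increase towards the root, so beyond the first key `≤ m` there is nothing to demote;
both versions of the loop therefore change the same keys. An idle visit is charged to the idle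
counter. -/
theorem ancestorSpec_updateAncestors (ho : IsLevelOrder S ord) (brk : Bool) (m : ℤ)
    (vs : List (Node α)) (hn : ∀ v ∈ vs, IsNode S v) (hd : vs.Nodup) (s : Store α)
    (hp : vs.Pairwise fun a b => nodeKey ord s b ≤ nodeKey ord s a) :
    AncestorSpec S ord brk m vs s (updateAncestors ord brk m vs s) := by
  induction vs generalizing s with
  | nil =>
    exact ⟨Evolves.refl s, fun _ _ _ => rfl, by simp, fun _ _ => le_rfl, le_rfl,
      fun _ => by simp [updateAncestors]⟩
  | cons v vs ih =>
    have hvm := (ho.mem_iff v).2 (hn v (by simp))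
    rw [List.nodup_cons] at hd
    rw [List.pairwise_cons] at hp
    have hn' : ∀ w ∈ vs, IsNode S w := fun w hw => hn w (List.mem_cons_of_mem _ hw)
    unfold updateAncestors
    split_ifs with h hb
    · have hev := (evolves_tick (ord := ord) s).trans (evolves_demote (iBFS_lt hvm) m s.tick)
      obtain ⟨hself1, hself2⟩ := nodeKey_demote_self (ord := ord) v m s.tick
      have hne : ∀ w, IsNode S w → w ≠ v → _ := fun w hw h =>
        nodeKey_demote_of_ne hvm ((ho.mem_iff w).2 hw) h m s.tick
      have hT := totalDemotes_demote (iBFS_lt hvm) (levels ord) m s.tick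
      have hidle : (s.tick.demote (levels ord) (iBFS ord v) m).idle = s.idle :=
        (setKey_frame _ _ _ _).2.2.2.2.2.2.1
      generalize s.tick.demote (levels ord) (iBFS ord v) m = s1 at *
      have hmv : ∀ w ∈ vs, w ≠ v := by rintro w hw rfl; exact hd.1 hw
      have hi := ih hn' hd.2 s1 (hp.2.imp_of_mem fun {a b} ha hb hab => by
        rw [(hne a (hn' a ha) (hmv a ha)).1, (hne b (hn' b hb) (hmv b hb)).1]; exact hab)
      generalize updateAncestors ord brk m vs s1 = s' at *
      refine ⟨(hev.trans hi.evolves).mono (by norm_num), fun w hw hwv => ?_, fun w hw => ?_,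
        fun w hw => ?_, ?_, fun hb => hidle ▸ hi.idle hb⟩
      · rw [List.mem_cons, not_or] at hwv
        rw [hi.off w hw hwv.2]
        exact (hne w hw hwv.1).1
      · rcases List.mem_cons.1 hw with rfl | hw
        · rw [hi.off w (hn w (by simp)) hd.1, hself1]
          have h1 : m < nodeKey ord s w := h
          exact (min_eq_right h1.le).symm
        · rw [hi.on w hw, (hne w (hn' w hw) (hmv w hw)).1]; rfl
      · refine (hi.demotes w hw).trans ?_
        by_cases hwv : w = v
        · subst hwv
          rw [hself1, hself2]
          have h1 : m < nodeKey ord s w := h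
          have h2 : nodeDemotes ord s.tick w = nodeDemotes ord s w := rfl
          push_cast
          omega
        · rw [(hne w hw hwv).1, (hne w hw hwv).2]; exact le_rfl
      · have := hi.totalDemotes_le
        have h2 : totalDemotes ord s.tick = totalDemotes ord s := rfl
        omega
    · have h' : nodeKey ord s v ≤ m := not_lt.1 h
      refine ⟨⟨rfl, rfl, rfl, rfl, id, ?_⟩, fun _ _ _ => rfl, fun w hw => ?_, fun _ _ => le_rfl,
        le_rfl, fun _ => le_rfl⟩
      · simp [Store.tick, totalDemotes]; linarith
      · refine (min_eq_left ?_).symm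
        rcases List.mem_cons.1 hw with rfl | hw
        · exact h'
        · exact (hp.1 w hw).trans h'
    · have h' : nodeKey ord s v ≤ m := not_lt.1 h
      have hi := ih hn' hd.2 { s.tick with idle := s.idle + 1 } hp.2
      have hev : Evolves ord 0 s { s.tick with idle := s.idle + 1 } := by
        refine ⟨rfl, rfl, rfl, rfl, id, ?_⟩
        simp [Store.tick, totalDemotes]; linarith
      refine ⟨(hev.trans hi.evolves).mono (by norm_num), fun w hw hwv => ?_, fun w hw => ?_,
        hi.demotes, hi.totalDemotes_le, fun hb' => absurd hb' hb⟩
      · exact hi.off w hw fun h1 => hwv (List.mem_cons_of_mem _ h1)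
      · rcases List.mem_cons.1 hw with rfl | hw
        · rw [min_eq_left h']
          exact hi.off w (hn w (by simp)) hd.1
        · exact hi.on w hw

end Procedures

/-! ### The invariant of the main loop, its preservation, and termination. -/

section MainLoop

variable {α : Type u} {γ : Type v} [DecidableEq α] [DecidableEq γ]
variable {S : ColoredString α γ} {y : γ} {ord : List (Node α)}

/-- The left-minimal pair `(u,d)` has been extracted. -/
def Done (S : ColoredString α γ) (y : γ) (ord : List (Node α)) (s : Store α) (u : Node α)
    (d : ℕ) : Prop :=
  d ≤ S.len + 1 ∧ LeftMinimal S y d u ∧ nodeKey ord s u < d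

/-- The invariant of the main loop. -/
structure Inv (S : ColoredString α γ) (y : γ) (ord : List (Node α)) (brk : Bool) (s : Store α) :
    Prop where
  heap : IsHeap (levels ord) (· < ord.length) s.key s.win
  tables : HasTables S y s
  neg_one_le : ∀ w, IsNode S w → -1 ≤ nodeKey ord s w
  mono : ∀ v w, IsNode S v → IsNode S w → v <+: w → nodeKey ord s v ≤ nodeKey ord s w
  leaf : ∀ w, IsLeaf S w → nodeKey ord s w = -1 ∨
    ∃ p : ℕ, nodeKey ord s w = p ∧ bit S y (w.length - 1 + p) = true
  closed : ∀ v w, IsNode S v → IsNode S w → v <+: w → ∀ d : ℕ, NodeUnique S y d v →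
    (d : ℤ) ≤ nodeKey ord s w → (d : ℤ) ≤ nodeKey ord s v
  demotes : ∀ w, IsNode S w → (nodeDemotes ord s w : ℤ) + nodeKey ord s w ≤ S.len + 1
  recorded : ∀ u, IsNode S u → ∀ p e, s.leftMinimal p (iBFS ord u) = some e →
    e % 2 = p ∧ LeftMinimal S y e u ∧ ∀ w, IsNode S w → nodeKey ord s w ≤ e
  recorded_of_done : ∀ u, IsNode S u → ∀ e, Done S y ord s u e →
    ∃ e' ≤ e, s.leftMinimal (e % 2) (iBFS ord u) = some e'
  out : ∀ T d, (T, d) ∈ s.out ↔ ∃ u v, IsNode S u ∧ parent S u = some v ∧ Done S y ord s u d ∧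
    leftMin S u = some T ∧ ¬ LeftMinimal S y (d + 1) (slinkNode S ord u v)
  cost : (s.time : ℤ) ≤ 2 * S.len + ord.length * (levels ord + 2) +
    ((levels ord : ℤ) + 8) * totalDemotes ord s + s.idle
  idle : brk = true → s.idle ≤ totalDemotes ord s

theorem report_frame (S : ColoredString α γ) (ord : List (Node α)) (u : Node α) (d : ℕ)
    (s : Store α) :
    ∃ o, report S ord u d s = { s.tick with out := o } ∧
      ∀ T e, (T, e) ∈ o ↔ (T, e) ∈ s.out ∨ (e = d ∧ ∃ v, parent S u = some v ∧
        leftMin S u = some T ∧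
        s.leftMinimal ((d + 1) % 2) (iBFS ord (slinkNode S ord u v)) ≠ some (d + 1)) := by
  unfold report
  cases hp : parent S u with
  | none => exact ⟨s.out, rfl, by simp⟩
  | some v =>
    cases hl : leftMin S u with
    | none => exact ⟨s.out, rfl, by simp⟩
    | some T =>
      simp only
      split_ifs with h
      · refine ⟨s.out, rfl, fun T' e => ?_⟩
        simp [h]
      · refine ⟨(T, d) :: s.out, rfl, fun T' e => ?_⟩
        simp only [List.mem_cons, Prod.mk.injEq, Option.some.injEq, exists_eq_left']
        constructor
        · rintro (⟨rfl, rfl⟩ | h')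
          · exact Or.inr ⟨rfl, rfl, h⟩
          · exact Or.inl h'
        · rintro (h' | ⟨rfl, rfl, -⟩)
          · exact Or.inr h'
          · exact Or.inl ⟨rfl, rfl⟩

theorem isNode_slinkNode (ho : IsLevelOrder S ord) {u : Node α} (hu : IsNode S u) (v : Node α) :
    IsNode S (slinkNode S ord u v) := by
  refine (isLocus_locusNode ho ?_).isNode
  exact ((List.tail_suffix _).isInfix.trans (List.take_prefix _ _).isInfix).trans hu.infix_text

/-- The keys after one iteration that extracts `u` with key `d`. -/
structure IterationSpec (S : ColoredString α γ) (y : γ) (ord : List (Node α)) (brk : Bool)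
    (u : Node α) (d : ℕ) (s s' : Store α) : Prop where
  tables : HasTables S y s'
  heap : IsHeap (levels ord) (· < ord.length) s'.key s'.win
  below : ∀ w, IsNode S w → u <+: w → -1 ≤ nodeKey ord s' w ∧ nodeKey ord s' w < d ∧
    ∀ e < d, NodeUnique S y e w → e ≤ nodeKey ord s' w
  mono : ∀ v w, IsNode S v → IsNode S w → u <+: v → v <+: w → nodeKey ord s' v ≤ nodeKey ord s' w
  leaf : ∀ w, IsLeaf S w → u <+: w → nodeKey ord s' w = -1 ∨
    ∃ p : ℕ, nodeKey ord s' w = p ∧ bit S y (w.length - 1 + p) = true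
  above : ∀ w, IsNode S w → w <+: u → w ≠ u →
    nodeKey ord s' w = min (nodeKey ord s w) (nodeKey ord s' u)
  off : ∀ w, IsNode S w → ¬ u <+: w → ¬ w <+: u → nodeKey ord s' w = nodeKey ord s w
  demotes : ∀ w, IsNode S w → nodeDemotes ord s' w + nodeKey ord s' w ≤
    nodeDemotes ord s w + nodeKey ord s w
  leftMinimal : s'.leftMinimal = Function.update s.leftMinimal (d % 2)
    (Function.update (s.leftMinimal (d % 2)) (iBFS ord u) (some d))
  out : ∀ T e, (T, e) ∈ s'.out ↔ (T, e) ∈ s.out ∨ (e = d ∧ ∃ v, parent S u = some v ∧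
    leftMin S u = some T ∧
    s.leftMinimal ((d + 1) % 2) (iBFS ord (slinkNode S ord u v)) ≠ some (d + 1))
  cost : (s'.time : ℤ) + ((levels ord : ℤ) + 8) * totalDemotes ord s + s.idle ≤
    s.time + ((levels ord : ℤ) + 8) * totalDemotes ord s' + s'.idle
  totalDemotes_lt : totalDemotes ord s < totalDemotes ord s'
  idle : brk = true → s'.idle ≤ s.idle + 1

theorem totalDemotes_lt_of_hSpec (ho : IsLevelOrder S ord) {d : ℕ} {u : Node α} (hu : IsNode S u)
    {s : Store α} {r : ℤ × Store α} (h : HSpec S y ord d u s r) :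
    totalDemotes ord s < totalDemotes ord r.2 := by
  refine Finset.sum_lt_sum (fun i hi => ?_) ⟨iBFS ord u, ?_, ?_⟩
  · obtain ⟨h1, h2⟩ := nodeOf_spec ho.nodup (Finset.mem_range.1 hi)
    have h3 := (ho.mem_iff _).1 h1
    have h4 : nodeDemotes ord s (nodeOf ord i) ≤ nodeDemotes ord r.2 (nodeOf ord i) := by
      by_cases hb : u <+: nodeOf ord i
      · rw [h.updated.demotes _ h3 hb]; omega
      · exact (h.off _ h3 hb).2.ge
    unfold nodeDemotes at h4
    rwa [h2] at h4
  · exact Finset.mem_range.2 (iBFS_lt ((ho.mem_iff u).2 hu))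
  · have := h.updated.demotes u hu List.prefix_rfl
    unfold nodeDemotes at this
    omega

theorem iterationSpec (ho : IsLevelOrder S ord) {brk : Bool} {s : Store α}
    (h : Inv S y ord brk s) (hneg : s.allNegative = false) :
    ∃ u, ∃ d : ℕ, IsNode S u ∧ nodeKey ord s u = d ∧ (∀ w, IsNode S w → nodeKey ord s w ≤ d) ∧
      (∀ w, IsNode S w → w <+: u → w ≠ u → nodeKey ord s w < d) ∧
      IterationSpec S y ord brk u d s (iteration S ord brk s.tick) := by
  have hroot : ([] : Node α) ∈ ord := (ho.mem_iff _).2 (isNode_nil S)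
  obtain ⟨i, hi, hmax, hbest⟩ := h.heap.max_spec
    (fun i hi => lt_of_lt_of_le hi (length_le_two_pow_levels ord)) ⟨_, iBFS_lt hroot⟩
  have hk : 0 ≤ s.key i := by
    simp only [Store.allNegative, hmax, decide_eq_false_iff_not] at hneg
    omega
  obtain ⟨hm, hui⟩ := nodeOf_spec ho.nodup hi
  have hit : iteration S ord brk s.tick =
      (fun r : ℤ × Store α => updateAncestors ord brk r.1 (ancestors S (nodeOf ord i)) r.2)
      (hProc S ord (S.len + 2) (nodeOf ord i) (s.key i).toNat (record ord (nodeOf ord i)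
        (s.key i).toNat (report S ord (nodeOf ord i) (s.key i).toNat s.tick.tick))) := by
    have h1 : s.tick.max = some (i, s.key i) := hmax
    unfold iteration
    rw [h1]
  rw [hit]
  clear hit
  generalize nodeOf ord i = u at *
  subst hui
  have hu := (ho.mem_iff u).1 hm
  obtain ⟨d, hd⟩ := Int.eq_ofNat_of_zero_le hk
  rw [hd, Int.toNat_natCast]
  have hKu : nodeKey ord s u = d := hd
  have hle : ∀ w, IsNode S w → nodeKey ord s w ≤ d := fun w hw => by
    have := hbest _ (iBFS_lt ((ho.mem_iff w).2 hw))
    unfold nodeKey; omega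
  -- An ancestor with the same key would have won the tie by its larger index.
  have hanc : ∀ w, IsNode S w → w <+: u → w ≠ u → nodeKey ord s w < d := fun w hw hwu hne => by
    have := hbest _ (iBFS_lt ((ho.mem_iff w).2 hw))
    have := iBFS_lt_of_prefix ho hw hu hwu hne
    unfold nodeKey; omega
  refine ⟨u, d, hu, hKu, hle, hanc, ?_⟩
  have hdn : d ≤ S.len + 1 := by have := h.demotes u hu; omega
  obtain ⟨o, hrep, hout⟩ := report_frame S ord u d s.tick.tick
  rw [hrep]
  generalize hs0 : record ord u d _ = s0
  have hkey : s0.key = s.key := by rw [← hs0]; rfl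
  have hdem : s0.demotes = s.demotes := by rw [← hs0]; rfl
  have hwin : s0.win = s.win := by rw [← hs0]; rfl
  have htime : s0.time = s.time + 4 := by rw [← hs0]; rfl
  have hidle : s0.idle = s.idle := by rw [← hs0]; rfl
  have ho0 : s0.out = o := by rw [← hs0]; rfl
  have hlm : s0.leftMinimal = Function.update s.leftMinimal (d % 2)
    (Function.update (s.leftMinimal (d % 2)) (iBFS ord u) (some d)) := by rw [← hs0]; rfl
  have hnk : ∀ w, nodeKey ord s0 w = nodeKey ord s w := fun w => by unfold nodeKey; rw [hkey]
  have hnd : ∀ w, nodeDemotes ord s0 w = nodeDemotes ord s w := fun w => by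
    unfold nodeDemotes; rw [hdem]
  have htd : totalDemotes ord s0 = totalDemotes ord s := by unfold totalDemotes; rw [hdem]
  have hH := hSpec_hProc ho hdn (S.len + 2) hu (by omega) s0
    (h.tables.congr (by rw [← hs0]; rfl) (by rw [← hs0]; rfl))
  have hlt := totalDemotes_lt_of_hSpec ho hu hH
  generalize hProc S ord (S.len + 2) u d s0 = r at *
  have hup : ∀ w, w <+: u → w ≠ u → ¬ u <+: w := fun w h1 h2 h3 =>
    h2 (h1.eq_of_length_le h3.length_le)
  -- The recursion works below `u` only, so the ancestors still have their old, monotone keys.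
  have hA := ancestorSpec_updateAncestors ho brk r.1 (ancestors S u)
    (fun v hv => (mem_ancestors.1 hv).1)
    ((pairwise_ancestors S u).imp fun h => h.2.symm) r.2
    ((pairwise_ancestors S u).imp_of_mem fun {a b} ha hb hab => by
      obtain ⟨ha1, ha2, ha3⟩ := mem_ancestors.1 ha
      obtain ⟨hb1, hb2, hb3⟩ := mem_ancestors.1 hb
      rw [(hH.off a ha1 (hup a ha2 ha3)).1, (hH.off b hb1 (hup b hb2 hb3)).1, hnk, hnk]
      exact h.mono b a hb1 ha1 hab.1)
  simp only
  generalize updateAncestors ord brk r.1 (ancestors S u) r.2 = s' at *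
  have hin : ∀ w, IsNode S w → u <+: w → nodeKey ord s' w = nodeKey ord r.2 w := fun w hw h1 =>
    hA.off w hw fun h2 => hup w (mem_ancestors.1 h2).2.1 (mem_ancestors.1 h2).2.2 h1
  have hev := hH.evolves.trans hA.evolves
  refine
    { tables := h.tables.congr ?_ ?_
      heap := hev.heap (by rw [hkey, hwin]; exact h.heap)
      below := fun w hw huw => ?_
      mono := fun v w hv hw huv hvw => ?_
      leaf := fun w hw huw => ?_
      above := fun w hw hwu hne => ?_
      off := fun w hw h1 h2 => ?_
      demotes := fun w hw => (hA.demotes w hw).trans ?_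
      leftMinimal := hev.leftMinimal.trans hlm
      out := fun T e => ?_
      cost := ?_
      totalDemotes_lt := ?_
      idle := fun hb => ?_ }
  · rw [hev.rank, ← hs0]; rfl
  · rw [hev.select, ← hs0]; rfl
  · rw [hin w hw huw]
    exact ⟨hH.updated.neg_one_le w hw huw, hH.updated.lt w hw huw,
      hH.updated.le_of_unique w hw huw⟩
  · rw [hin v hv huv, hin w hw (huv.trans hvw)]
    exact hH.updated.mono v w hv hw huv hvw
  · rw [hin w hw.isNode huw]
    exact hH.updated.leaf w hw huw
  · rw [hA.on w (mem_ancestors.2 ⟨hw, hwu, hne⟩), (hH.off w hw (hup w hwu hne)).1, hnk, hH.val,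
      hin u hu List.prefix_rfl]
  · rw [hA.off w hw fun h3 => h2 (mem_ancestors.1 h3).2.1, (hH.off w hw h1).1, hnk]
  -- Below `u` one demotion is added while the key falls strictly, from at least `d` to less than
  -- `d`.
  · by_cases huw : u <+: w
    · have h1 := hH.updated.demotes w hw huw
      have h2 := hH.updated.lt w hw huw
      have h3 := h.mono u w hu hw huw
      rw [hnd] at h1
      omega
    · rw [(hH.off w hw huw).1, (hH.off w hw huw).2, hnk, hnd]
  · rw [hev.out, ho0]
    exact hout T e
  · have := hev.cost
    rw [htime, hidle, htd] at this
    push_cast at this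
    linarith
  · have := hA.totalDemotes_le
    omega
  · have := hA.idle hb
    rw [hH.idle, hidle] at this
    exact this

/-- The heart of the correctness proof: the extracted pair is left-minimal, and it is the only
left-minimal pair that becomes done in this iteration. -/
theorem inv_of_iterationSpec (ho : IsLevelOrder S ord) {brk : Bool} {s s' : Store α}
    (h : Inv S y ord brk s) {u : Node α} {d : ℕ} (hu : IsNode S u) (hKu : nodeKey ord s u = d)
    (hle : ∀ w, IsNode S w → nodeKey ord s w ≤ d)
    (hanc : ∀ w, IsNode S w → w <+: u → w ≠ u → nodeKey ord s w < d)
    (hi : IterationSpec S y ord brk u d s s') : Inv S y ord brk s' := by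
  have hdn : d ≤ S.len + 1 := by have := h.demotes u hu; omega
  have hbel : ∀ w, IsNode S w → u <+: w → nodeKey ord s w = d := fun w hw huw => by
    have := hle w hw; have := h.mono u w hu hw huw; omega
  have hu' := hi.below u hu List.prefix_rfl
  have hcase : ∀ w : Node α, u <+: w ∨ (w <+: u ∧ w ≠ u) ∨ (¬ u <+: w ∧ ¬ w <+: u) := by
    intro w
    by_cases h1 : u <+: w
    · exact Or.inl h1
    · by_cases h2 : w <+: u
      · exact Or.inr (Or.inl ⟨h2, fun h3 => h1 (h3 ▸ List.prefix_rfl)⟩)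
      · exact Or.inr (Or.inr ⟨h1, h2⟩)
  have hdec : ∀ w, IsNode S w → nodeKey ord s' w ≤ nodeKey ord s w := fun w hw => by
    rcases hcase w with h1 | ⟨h1, h2⟩ | ⟨h1, h2⟩
    · have := hi.below w hw h1; have := hbel w hw h1; omega
    · rw [hi.above w hw h1 h2]; exact min_le_left _ _
    · rw [hi.off w hw h1 h2]
  -- Every leaf below `u` has key `d`, hence its bit with delay `d` is set. By `closed`, an ancestor
  -- unique with delay `d` would still have key at least `d`, against `hanc`.
  have hLM : LeftMinimal S y d u := by
    refine ⟨fun w hw huw => ?_, fun p hp hpu hne hun => ?_⟩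
    · have h1 := hbel w hw.isNode huw
      rcases h.leaf w hw with h2 | ⟨p, h2, h3⟩
      · omega
      · obtain rfl : p = d := by omega
        exact h3
    · have := h.closed p u hp hu hpu d hun hKu.ge
      have := hanc p hp hpu hne
      omega
  -- The only unique delay that can be lost is `d` itself, at or below `u`. An ancestor is lowered
  -- at most to the new key of `u`, which inherits every unique delay `e < d` of the ancestor.
  have hkeep : ∀ w, IsNode S w → ∀ e : ℕ, NodeUnique S y e w → (e : ℤ) ≤ nodeKey ord s w →
      (e : ℤ) ≤ nodeKey ord s' w ∨ (u <+: w ∧ e = d) := by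
    intro w hw e hun hek
    rcases hcase w with h1 | ⟨h1, h2⟩ | ⟨h1, h2⟩
    · have h3 := hle w hw
      by_cases hed : e = d
      · exact Or.inr ⟨h1, hed⟩
      · exact Or.inl ((hi.below w hw h1).2.2 e (by omega) hun)
    · have h3 := hanc w hw h1 h2
      rw [hi.above w hw h1 h2]
      exact Or.inl (le_min hek (hu'.2.2 e (by omega) (hun.of_prefix h1)))
    · rw [hi.off w hw h1 h2]; exact Or.inl hek
  -- A proper descendant of `u` also passes `d`, but it is not left-minimal there, as its ancestor
  -- `u` is unique.
  have hdone : ∀ w, IsNode S w → ∀ e, Done S y ord s' w e ↔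
      Done S y ord s w e ∨ (w = u ∧ e = d) := by
    intro w hw e
    constructor
    · rintro ⟨h1, h2, h3⟩
      by_cases h4 : nodeKey ord s w < e
      · exact Or.inl ⟨h1, h2, h4⟩
      · rcases hkeep w hw e h2.1 (not_lt.1 h4) with h5 | ⟨h5, rfl⟩
        · omega
        · refine Or.inr ⟨?_, rfl⟩
          by_contra hne
          exact h2.2 u hu h5 (Ne.symm hne) hLM.1
    · rintro (⟨h1, h2, h3⟩ | ⟨rfl, rfl⟩)
      · exact ⟨h1, h2, (hdec w hw).trans_lt h3⟩
      · exact ⟨hdn, hLM, hu'.2.1⟩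
  refine
    { heap := hi.heap
      tables := hi.tables
      neg_one_le := fun w hw => ?_
      mono := fun v w hv hw hvw => ?_
      leaf := fun w hw => ?_
      closed := fun v w hv hw hvw e hun hew => ?_
      demotes := fun w hw => (hi.demotes w hw).trans (h.demotes w hw)
      recorded := fun w hw p e he => ?_
      recorded_of_done := fun w hw e he => ?_
      out := fun T e => ?_
      cost := by have := hi.cost; have := h.cost; linarith
      idle := fun hb => by
        have := hi.idle hb; have := h.idle hb; have := hi.totalDemotes_lt; omega }
  · rcases hcase w with h1 | ⟨h1, h2⟩ | ⟨h1, h2⟩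
    · exact (hi.below w hw h1).1
    · rw [hi.above w hw h1 h2]; exact le_min (h.neg_one_le w hw) hu'.1
    · rw [hi.off w hw h1 h2]; exact h.neg_one_le w hw
  · rcases hcase v with h1 | ⟨h1, h2⟩ | ⟨h1, h2⟩
    · exact hi.mono v w hv hw h1 hvw
    · rw [hi.above v hv h1 h2]
      rcases hcase w with h3 | ⟨h3, h4⟩ | ⟨h3, h4⟩
      · exact (min_le_right _ _).trans (hi.mono u w hu hw List.prefix_rfl h3)
      · rw [hi.above w hw h3 h4]
        exact min_le_min_right _ (h.mono v w hv hw hvw)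
      · rw [hi.off w hw h3 h4]
        exact (min_le_left _ _).trans (h.mono v w hv hw hvw)
    · rw [hi.off v hv h1 h2]
      have h3 : ¬ w <+: u := fun h3 => h2 (hvw.trans h3)
      have h4 : ¬ u <+: w := fun h4 => by
        rcases List.prefix_or_prefix_of_prefix hvw h4 with h5 | h5
        · exact h2 h5
        · exact h1 h5
      rw [hi.off w hw h4 h3]
      exact h.mono v w hv hw hvw
  · rcases hcase w with h1 | ⟨h1, h2⟩ | ⟨h1, h2⟩
    · exact hi.leaf w hw h1
    · exact absurd (hw.eq_of_prefix hu.infix_text h1).symm h2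
    · rw [hi.off w hw.isNode h1 h2]; exact h.leaf w hw
  · have h1 := h.closed v w hv hw hvw e hun (hew.trans (hdec w hw))
    rcases hkeep v hv e hun h1 with h2 | ⟨h2, rfl⟩
    · exact h2
    · have := (hi.below w hw (h2.trans hvw)).2.1
      omega
  · rw [hi.leftMinimal] at he
    have hold : s.leftMinimal p (iBFS ord w) = some e →
        e % 2 = p ∧ LeftMinimal S y e w ∧ ∀ w, IsNode S w → nodeKey ord s' w ≤ e := fun h1 => by
      obtain ⟨h2, h3, h4⟩ := h.recorded w hw p e h1
      exact ⟨h2, h3, fun w hw => (hdec w hw).trans (h4 w hw)⟩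
    by_cases hp : p = d % 2
    · subst hp
      rw [Function.update_self] at he
      by_cases hwu : w = u
      · subst hwu
        rw [Function.update_self, Option.some.injEq] at he
        subst he
        exact ⟨rfl, hLM, fun w hw => (hdec w hw).trans (hle w hw)⟩
      · rw [Function.update_of_ne fun hc => hwu (iBFS_inj ((ho.mem_iff w).2 hw)
          ((ho.mem_iff u).2 hu) hc)] at he
        exact hold he
    · rw [Function.update_of_ne hp] at he
      exact hold he
  · rw [hi.leftMinimal]
    by_cases hwu : w = u
    · subst hwu
      by_cases hp : e % 2 = d % 2
      · refine ⟨d, ?_, by rw [hp, Function.update_self, Function.update_self]⟩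
        rcases (hdone w hw e).1 he with h1 | h1
        · have := h1.2.2; omega
        · exact h1.2.ge
      · rw [Function.update_of_ne hp]
        rcases (hdone w hw e).1 he with h1 | h1
        · exact h.recorded_of_done w hw e h1
        · exact absurd (by rw [h1.2]) hp
    · have h1 : Done S y ord s w e := ((hdone w hw e).1 he).resolve_right fun hc => hwu hc.1
      obtain ⟨e', he', h2⟩ := h.recorded_of_done w hw e h1
      refine ⟨e', he', ?_⟩
      have hne : iBFS ord w ≠ iBFS ord u := fun hc => hwu (iBFS_inj ((ho.mem_iff w).2 hw)
          ((ho.mem_iff u).2 hu) hc)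
      by_cases hp : e % 2 = d % 2
      · rw [hp, Function.update_self, Function.update_of_ne hne, ← hp, h2]
      · rw [Function.update_of_ne hp, h2]
  · have hcheck : ∀ v, parent S u = some v → leftMin S u = some T →
        (s.leftMinimal ((d + 1) % 2) (iBFS ord (slinkNode S ord u v)) = some (d + 1) ↔
          LeftMinimal S y (d + 1) (slinkNode S ord u v)) := by
      intro v hv hT
      have hn := isNode_slinkNode ho hu v
      refine ⟨fun h1 => (h.recorded _ hn _ _ h1).2.1, fun h1 => ?_⟩
      have hvp := (parent_eq_some.1 hv).1
      have hdn' : d + 1 ≤ S.len + 1 := by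
        by_contra hc
        exact hLM.2 v hvp.1 hvp.2.1 hvp.2.2 (nodeUnique_of_len_lt (by omega) v)
      have hle' := hle _ hn
      -- The recorded `e'` is at most `d + 1`, has its parity, and is at least the current key `d`
      -- of `u`; so it equals `d + 1`. This is why one entry per parity suffices.
      obtain ⟨e', he', h2⟩ := h.recorded_of_done _ hn (d + 1) ⟨hdn', h1, by push_cast; omega⟩
      obtain ⟨h3, -, h4⟩ := h.recorded _ hn _ _ h2
      have h5 := h4 u hu
      rw [h2, Option.some.injEq]
      omega
    rw [hi.out, h.out]
    constructor
    · rintro (⟨w, v, hw, hv, h1, h2⟩ | ⟨rfl, v, hv, hT, h1⟩)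
      · exact ⟨w, v, hw, hv, (hdone w hw e).2 (Or.inl h1), h2⟩
      · exact ⟨u, v, hu, hv, (hdone u hu e).2 (Or.inr ⟨rfl, rfl⟩), hT,
          fun h2 => h1 ((hcheck v hv hT).2 h2)⟩
    · rintro ⟨w, v, hw, hv, h1, hT, h2⟩
      rcases (hdone w hw e).1 h1 with h3 | ⟨rfl, rfl⟩
      · exact Or.inl ⟨w, v, hw, hv, h3, hT, h2⟩
      · exact Or.inr ⟨rfl, v, hv, hT, fun h3 => h2 ((hcheck v hv hT).1 h3)⟩

theorem Inv.totalDemotes_le (ho : IsLevelOrder S ord) {brk : Bool} {s : Store α}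
    (h : Inv S y ord brk s) : totalDemotes ord s ≤ ord.length * (S.len + 2) := by
  unfold totalDemotes
  refine (Finset.sum_le_card_nsmul _ _ (S.len + 2) fun i hi => ?_).trans (by simp)
  obtain ⟨h1, h2⟩ := nodeOf_spec ho.nodup (Finset.mem_range.1 hi)
  have h3 := (ho.mem_iff _).1 h1
  have h4 := h.demotes _ h3
  have h5 := h.neg_one_le _ h3
  unfold nodeDemotes at h4
  rw [h2] at h4
  omega

/-- Each iteration raises the total number of demotions, which is bounded; `N` exceeds what remains
of that budget. -/
theorem exists_while (ho : IsLevelOrder S ord) {brk : Bool} (N : ℕ) (s : Store α)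
    (h : Inv S y ord brk s) (hN : ord.length * (S.len + 2) < N + totalDemotes ord s) :
    ∃ t : Store α, While S ord brk s t.tick ∧ Inv S y ord brk t ∧ t.allNegative = true := by
  induction N generalizing s with
  | zero => have := h.totalDemotes_le ho; omega
  | succ N ih =>
    cases hneg : s.allNegative with
    | true => exact ⟨s, While.done s hneg, h, hneg⟩
    | false =>
      obtain ⟨u, d, hu, h1, h2, h3, hi⟩ := iterationSpec ho h hneg
      obtain ⟨t, ht, h4⟩ := ih _ (inv_of_iterationSpec ho h hu h1 h2 h3 hi)
        (by have := hi.totalDemotes_lt; omega)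
      exact ⟨t, While.next s _ hneg ht, h4⟩

theorem Inv.key_neg (ho : IsLevelOrder S ord) {brk : Bool} {s : Store α}
    (h : Inv S y ord brk s) (hneg : s.allNegative = true) (w : Node α) (hw : IsNode S w) :
    nodeKey ord s w < 0 := by
  have hw' := iBFS_lt ((ho.mem_iff w).2 hw)
  obtain ⟨i, hi, hmax, hbest⟩ := h.heap.max_spec
    (fun i hi => lt_of_lt_of_le hi (length_le_two_pow_levels ord)) ⟨_, hw'⟩
  simp only [Store.allNegative, hmax, decide_eq_true_eq] at hneg
  have := hbest _ hw'
  unfold nodeKey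
  omega

theorem foldl_insert_spec (k : ℤ) (s : Store α) (hs : ∀ i, s.win i = none) (l : List (Node α))
    (hl : ∀ u ∈ l, u ∈ ord) :
    let t := l.foldl (fun s u => s.tick.insert (levels ord) (iBFS ord u) k) s
    IsHeap (levels ord) (fun j => ∃ u ∈ l, iBFS ord u = j) t.key t.win ∧
      (∀ u ∈ l, t.key (iBFS ord u) = k) ∧ t.rank = s.rank ∧ t.select = s.select ∧
      t.leftMinimal = s.leftMinimal ∧ t.out = s.out ∧ t.demotes = s.demotes ∧ t.idle = s.idle ∧
      t.time = s.time + l.length * (levels ord + 2) := by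
  induction l using List.reverseRecOn with
  | nil =>
    refine ⟨fun z _ _ => ⟨fun _ i _ => by simp, fun j hj => ?_⟩, by simp, rfl, rfl, rfl, rfl, rfl,
      rfl, by simp⟩
    rw [List.foldl_nil, hs] at hj
    cases hj
  | append_singleton l u ih =>
    simp only [List.foldl_append, List.foldl_cons, List.foldl_nil] at ih ⊢
    obtain ⟨h1, h2, h3, h4, h5, h6, h7, h8, h9⟩ := ih fun w hw => hl w (by simp [hw])
    generalize List.foldl _ s l = t at *
    unfold Store.insert
    obtain ⟨g1, g2, g3, g4, g5, g6, g7, g8⟩ := setKey_frame (levels ord) (iBFS ord u) k t.tick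
    refine ⟨isHeap_setKey (I := fun j => ∃ u ∈ l, iBFS ord u = j)
        (lt_of_lt_of_le (iBFS_lt (hl u (by simp))) (length_le_two_pow_levels ord)) h1 fun j => ?_,
      fun w hw => ?_, g2.trans h3, g3.trans h4, g4.trans h5, g5.trans h6, g6.trans h7, g7.trans h8,
      ?_⟩
    · simp only [List.mem_append, List.mem_singleton, or_and_right, exists_or, exists_eq_left]
      exact or_congr_right eq_comm
    · rw [g1]
      by_cases hc : iBFS ord w = iBFS ord u
      · rw [hc, Function.update_self]
      · rw [Function.update_of_ne hc]
        refine h2 w ?_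
        rcases List.mem_append.1 hw with h | h
        · exact h
        · rw [List.mem_singleton.1 h] at hc; exact absurd rfl hc
    · rw [g8, List.length_append, List.length_singleton]
      simp only [Store.tick, h9]
      ring

/-- With delay `n + 1` every leaf points past the end of the string, where all bits are set. No pair
is done, because `Done` requires a delay of at most `n + 1` that exceeds the key. -/
theorem inv_start (ho : IsLevelOrder S ord) (brk : Bool) :
    Inv S y ord brk (start S y ord) ∧ totalDemotes ord (start S y ord : Store α) = 0 := by
  obtain ⟨p1, p2, p3, p4, p5, p6, p7⟩ := preprocess_spec (α := α) S y
  obtain ⟨h1, h2, h3, h4, h5, h6, h7, h8, h9⟩ := foldl_insert_spec (ord := ord) ((S.len : ℤ) + 1)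
    (Store.preprocess S y Store.empty : Store α) p2 ord fun _ h => h
  unfold start
  generalize List.foldl _ (Store.preprocess S y Store.empty : Store α) ord = s at *
  have hkey : ∀ w, IsNode S w → nodeKey ord s w = S.len + 1 := fun w hw =>
    h2 w ((ho.mem_iff w).2 hw)
  have hnd : ∀ w, nodeDemotes ord s w = 0 := fun w => by unfold nodeDemotes; rw [h7, p5]
  have hndone : ∀ w, IsNode S w → ∀ e, ¬ Done S y ord s w e := by
    rintro w hw e ⟨g1, -, g3⟩
    rw [hkey w hw] at g3
    omega
  have htd : totalDemotes ord s = 0 := by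
    unfold totalDemotes
    exact Finset.sum_eq_zero fun i _ => by rw [h7, p5]
  refine
    ⟨{ heap := ?_
       tables := fun q hq => by rw [h3, h4]; exact p1.pred q hq
       neg_one_le := fun w hw => by rw [hkey w hw]; omega
       mono := fun v w hv hw _ => by rw [hkey v hv, hkey w hw]
       leaf := fun w hw => Or.inr ⟨S.len + 1, by rw [hkey w hw.isNode]; norm_num, ?_⟩
       closed := fun v w hv hw _ d _ hd => by rw [hkey v hv]; rwa [hkey w hw] at hd
       demotes := fun w hw => by rw [hkey w hw, hnd]; simp
       recorded := fun u _ p e he => by rw [h5, p3] at he; cases he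
       recorded_of_done := fun u hu e he => absurd he (hndone u hu e)
       out := fun T d => ?_
       cost := ?_
       idle := fun _ => by rw [h8, p6]; omega }, htd⟩
  · have : (fun j => ∃ u ∈ ord, iBFS ord u = j) = (· < ord.length) := by
      funext j
      refine propext ⟨?_, fun h => ⟨_, (nodeOf_spec ho.nodup h).1, (nodeOf_spec ho.nodup h).2⟩⟩
      rintro ⟨u, hu, rfl⟩
      exact iBFS_lt hu
    rw [← this]
    exact h1
  · have : S.len < w.length - 1 + (S.len + 1) := by omega
    simp [bit, this]
  · rw [h6, p4]
    simp only [List.not_mem_nil, false_iff]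
    rintro ⟨u, v, hu, -, hd, -⟩
    exact hndone u hu d hd
  · rw [h9, p7, h8, p6, htd]
    push_cast
    linarith

end MainLoop

/-! ### Number of nodes and the final numerical estimate. -/

section NodeCount

/-- The strings at which the trie of the strings in `l` branches. -/
def branching {β : Type*} (l : List (List β)) : Set (List β) :=
  {u | ∃ a b, a ≠ b ∧ (∃ t ∈ l, u ++ [a] <+: t) ∧ ∃ t ∈ l, u ++ [b] <+: t}

/-- A further string creates at most one branching node. -/
theorem subsingleton_branching_cons {β : Type*} (s : List β) (l : List (List β)) :
    (branching (s :: l) \ branching l).Subsingleton := by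
  have hmem : ∀ u ∈ branching (s :: l) \ branching l, ∃ a b, a ≠ b ∧ u ++ [a] <+: s ∧
      ∃ t ∈ l, u ++ [b] <+: t := by
    rintro u ⟨⟨a, b, hab, ⟨t, ht, hat⟩, ⟨t', ht', hbt⟩⟩, hn⟩
    rcases List.mem_cons.1 ht with rfl | h1 <;> rcases List.mem_cons.1 ht' with rfl | h2
    · have h := (List.prefix_of_prefix_length_le hat hbt (by simp)).eq_of_length (by simp)
      simp at h
      exact absurd h hab
    · exact ⟨a, b, hab, hat, t', h2, hbt⟩
    · exact ⟨b, a, hab.symm, hbt, t, h1, hat⟩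
    · exact absurd ⟨a, b, hab, ⟨t, h1, hat⟩, ⟨t', h2, hbt⟩⟩ hn
  have key : ∀ u ∈ branching (s :: l) \ branching l, ∀ w ∈ branching (s :: l) \ branching l,
      ¬ u.length < w.length := by
    intro u hu w hw hlt
    obtain ⟨a, b, hab, hus, t, ht, hut⟩ := hmem u hu
    obtain ⟨c, d, -, hws, t', ht', hwt⟩ := hmem w hw
    have h1 : u ++ [a] <+: w := List.prefix_of_prefix_length_le hus
      ((List.prefix_append w [c]).trans hws) (by simpa using hlt)
    exact hu.2 ⟨a, b, hab, ⟨t', ht', h1.trans ((List.prefix_append w [d]).trans hwt)⟩, t, ht, hut⟩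
  intro u hu w hw
  obtain ⟨a, b, -, hus, -⟩ := hmem u hu
  obtain ⟨c, d, -, hws, -⟩ := hmem w hw
  have h1 := key u hu w hw
  have h2 := key w hw u hu
  exact (List.prefix_of_prefix_length_le ((List.prefix_append u [a]).trans hus)
    ((List.prefix_append w [c]).trans hws) (by omega)).eq_of_length (by omega)

theorem exists_branching_subset {β : Type*} (l : List (List β)) :
    ∃ F : List (List β), F.length ≤ l.length ∧ ∀ u ∈ branching l, u ∈ F := by
  induction l with
  | nil => exact ⟨[], le_rfl, by rintro u ⟨a, b, -, ⟨t, ht, -⟩, -⟩; simp at ht⟩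
  | cons s l ih =>
    obtain ⟨F, hF, hsub⟩ := ih
    have hss := subsingleton_branching_cons s l
    by_cases hne : (branching (s :: l) \ branching l).Nonempty
    · obtain ⟨w, hw⟩ := hne
      refine ⟨w :: F, by simpa using hF, fun u hu => ?_⟩
      by_cases hul : u ∈ branching l
      · exact List.mem_cons_of_mem _ (hsub u hul)
      · rw [hss ⟨hu, hul⟩ hw]; simp
    · refine ⟨F, hF.trans (by simp), fun u hu => hsub u ?_⟩
      by_contra hul
      exact hne ⟨u, hu, hul⟩

variable {α : Type u} {γ : Type v} [DecidableEq α] {S : ColoredString α γ} {ord : List (Node α)}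

/-- The suffix tree has linearly many nodes. -/
theorem length_le_of_isLevelOrder (ho : IsLevelOrder S ord) : ord.length ≤ 2 * S.len + 4 := by
  -- There are `n + 2` suffixes, counting the empty one for the root, and at most as many branching
  -- nodes.
  obtain ⟨F, hF, hsub⟩ := exists_branching_subset (text S).tails
  have hl : (text S).tails.length = S.len + 2 := by
    simp [List.length_tails, text, ColoredString.len]
  have hss : ord ⊆ (text S).tails ++ F := by
    intro u hu
    rw [List.mem_append, List.mem_tails]
    rcases (ho.mem_iff u).1 hu with rfl | h | ⟨a, -, b, -, hab, ha, hb⟩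
    · exact Or.inl List.nil_suffix
    · exact Or.inl h.2
    · refine Or.inr (hsub u ⟨a, b, hab, ?_, ?_⟩)
      · obtain ⟨t, h1, h2⟩ := List.infix_iff_prefix_suffix.1 ha
        exact ⟨t, (List.mem_tails _ _).2 h2, h1⟩
      · obtain ⟨t, h1, h2⟩ := List.infix_iff_prefix_suffix.1 hb
        exact ⟨t, (List.mem_tails _ _).2 h2, h1⟩
  have := (ho.nodup.subperm hss).length_le
  rw [List.length_append, hl] at this
  omega

theorem steps_bound {n k L : ℕ} (hn : 2 ≤ n) (hk : k ≤ 2 * n + 4) (hk2 : 2 ≤ k)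
    (hL : L = Nat.clog 2 k) :
    (2 * n + k * (L + 2) + (L + 8) * (k * (n + 2)) + k * (n + 2) + 1 : ℝ) ≤
      160 / Real.log 2 * ((n : ℝ) ^ 2 * Real.log n) := by
  have hlog2 : 0 < Real.log 2 := Real.log_pos (by norm_num)
  have hnR : (2 : ℝ) ≤ n := by exact_mod_cast hn
  have hkR : (k : ℝ) ≤ 4 * n := by
    have : k ≤ 4 * n := by omega
    exact_mod_cast this
  set x : ℝ := Real.log n / Real.log 2 with hx
  have hx1 : 1 ≤ x := by
    rw [hx, one_le_div hlog2]
    exact Real.log_le_log (by norm_num) hnR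
  have hLx : (L : ℝ) ≤ 4 * x := by
    have h1 : 2 ^ (L - 1) < k := by
      rw [hL]; exact Nat.pow_pred_clog_lt_self (by norm_num) (by omega)
    -- `k ≤ 4 * n ≤ n ^ 3` for `n ≥ 2`; hence `L - 1 ≤ 3 * x`, where `x` is the binary logarithm of
    -- `n`.
    have h2 : (2 : ℝ) ^ (L - 1) ≤ (n : ℝ) ^ 3 := by
      have h3 : (2 : ℝ) ^ (L - 1) ≤ k := by exact_mod_cast h1.le
      nlinarith [mul_nonneg (by linarith : (0 : ℝ) ≤ n) (by nlinarith : (0 : ℝ) ≤ n ^ 2 - 4)]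
    have h3 := Real.log_le_log (by positivity) h2
    rw [Real.log_pow, Real.log_pow] at h3
    have h4 : ((L - 1 : ℕ) : ℝ) ≤ 3 * x := by
      rw [hx, ← mul_div_assoc, le_div_iff₀ hlog2]
      exact_mod_cast h3
    have h5 : (L : ℝ) ≤ ((L - 1 : ℕ) : ℝ) + 1 := by
      have : L ≤ L - 1 + 1 := by omega
      exact_mod_cast this
    linarith
  have hgoal : 160 / Real.log 2 * ((n : ℝ) ^ 2 * Real.log n) = 160 * (n ^ 2 * x) := by
    rw [hx]; field_simp
  rw [hgoal]
  have hk0 : (0 : ℝ) ≤ k := Nat.cast_nonneg k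
  have hL0 : (0 : ℝ) ≤ L := Nat.cast_nonneg L
  -- The terms with factor `k` add up to at most `(L + 9) * (k * (n + 3))`. This gives `156`, the
  -- remaining terms give `3`, and `160` covers both.
  have h1 : (L + 9 : ℝ) * (k * (n + 3)) ≤ (13 * x) * (4 * n * (3 * n)) := by
    have h2 : (L + 9 : ℝ) ≤ 13 * x := by linarith
    have h3 : (n + 3 : ℝ) ≤ 3 * n := by linarith
    gcongr
  have h2 : (2 * n + 1 : ℝ) ≤ 3 * (n ^ 2 * x) := by
    have : (n : ℝ) ^ 2 * 1 ≤ n ^ 2 * x := by gcongr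
    nlinarith
  nlinarith [mul_nonneg hk0 hL0]

end NodeCount

end ColoredStrings

open ColoredStrings in
theorem mainTheorem3 :
    ∃ C : ℝ, ∀ (α : Type*) (γ : Type*) [DecidableEq α] [DecidableEq γ]
      (S : ColoredStrings.ColoredString α γ) (y : γ) (ord : List (ColoredStrings.Node α)),
      ColoredStrings.IsLevelOrder S ord →
      ∀ brk : Bool, ∃ t : ColoredStrings.Store α,
        ColoredStrings.SkippingEndsIn S y ord brk t ∧
        (∀ (T : List α) (d : ℕ), (T, d) ∈ t.out ↔
          T ≠ [] ∧ d ≤ S.len ∧ ColoredStrings.IsMinUnique S y d T) ∧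
        (∀ u : ColoredStrings.Node α, ColoredStrings.IsNode S u →
          t.demotes (ColoredStrings.iBFS ord u) ≤ S.len + 2) ∧
        (2 ≤ S.len →
          (t.time : ℝ) ≤ C * ((S.len : ℝ) ^ 2 * Real.log S.len) + (t.idle : ℝ)) ∧
        (2 ≤ S.len → brk = true →
          (t.time : ℝ) ≤ C * ((S.len : ℝ) ^ 2 * Real.log S.len)) := by
  refine ⟨160 / Real.log 2, fun α γ _ _ S y ord ho brk => ?_⟩
  obtain ⟨h0, h1⟩ := inv_start (y := y) ho brk
  obtain ⟨t, ht, h, hneg⟩ := exists_while ho (ord.length * (S.len + 2) + 1) _ h0 (by omega)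
  have hkn := h.key_neg ho hneg
  have hD := h.totalDemotes_le ho
  have hcost : (t.tick.time : ℝ) ≤ 2 * S.len + ord.length * (levels ord + 2) +
      (levels ord + 8) * (ord.length * (S.len + 2)) + 1 + t.idle := by
    have h2 : t.time ≤ 2 * S.len + ord.length * (levels ord + 2) +
        (levels ord + 8) * totalDemotes ord t + t.idle := by exact_mod_cast h.cost
    have h3 := Nat.mul_le_mul_left (levels ord + 8) hD
    have h4 : t.tick.time ≤ 2 * S.len + ord.length * (levels ord + 2) +
        (levels ord + 8) * (ord.length * (S.len + 2)) + 1 + t.idle := by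
      simp only [Store.tick]; omega
    exact_mod_cast h4
  have hbound : 2 ≤ S.len → (2 * S.len + ord.length * (levels ord + 2) +
      (levels ord + 8) * (ord.length * (S.len + 2)) + ord.length * (S.len + 2) + 1 : ℝ) ≤
      160 / Real.log 2 * ((S.len : ℝ) ^ 2 * Real.log S.len) := fun hn => by
    refine steps_bound hn (length_le_of_isLevelOrder ho) ?_ rfl
    -- The root and the leaf of the whole text are two distinct nodes, so `k ≥ 2`.
    have h2 : [([] : Node α), text S] ⊆ ord := by
      intro u hu
      rw [ho.mem_iff]
      simp only [List.mem_cons, List.not_mem_nil, or_false] at hu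
      rcases hu with rfl | rfl
      · exact isNode_nil S
      · exact IsLeaf.isNode ⟨by simp [text], List.suffix_refl _⟩
    have h3 : [([] : Node α), text S].Nodup := by simp [text]
    simpa using (h3.subperm h2).length_le
  refine ⟨t.tick, ht, fun T d => ?_, fun u hu => ?_, fun hn => ?_, fun hn hb => ?_⟩
  · rw [isMinUnique_iff_exists ho]
    refine (h.out T d).trans (exists_congr fun u => exists_congr fun v => ?_)
    constructor
    · rintro ⟨hu, hv, hd, h2⟩
      exact ⟨hu, hv, hd.2.1, h2⟩
    · rintro ⟨hu, hv, hd, h2⟩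
      have hvp := (parent_eq_some.1 hv).1
      refine ⟨hu, hv, ⟨?_, hd, ?_⟩, h2⟩
      -- A left-minimal node with a parent cannot have a delay beyond `n`, since the parent would be
      -- unique as well.
      · by_contra hc
        exact hd.2 v hvp.1 hvp.2.1 hvp.2.2 (nodeUnique_of_len_lt (by omega) v)
      · have := hkn u hu; omega
  · have h2 := h.demotes u hu
    have h3 := h.neg_one_le u hu
    unfold nodeDemotes at h2
    change t.demotes (iBFS ord u) ≤ _
    omega
  · refine hcost.trans ?_
    have h2 := hbound hn
    have h3 : (0 : ℝ) ≤ ord.length * (S.len + 2) := by positivity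
    have h4 : (t.tick.idle : ℝ) = t.idle := rfl
    rw [h4]
    linarith
  · refine hcost.trans ((le_trans ?_) (hbound hn))
    have h2 : (t.idle : ℝ) ≤ ord.length * (S.len + 2) := by
      exact_mod_cast (h.idle hb).trans hD
    linarith
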